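/- Let $G$ be a nonempty plane 1-periodic graph: a graph with signed edges $\sigma_e=\pm1$ (loops and multiple edges allowed, isolated vertices not allowed, not necessarily connected) embedded in the strip $(0,1)\times\mathbb R$ and invariant under the translation $x:(s,t)\mapsto(s,t+1)$, such that the free $\mathbb Z$-action generated by $x$ preserves signs and the quotient $\overline G$, a graph in the annulus $\mathbb A=(0,1)\times S^1$, is finite. Choose representatives $v_{1,0},\dots,v_{n,0}$ of the vertex orbits and put $v_{i,k}=x^k v_{i,0}$. The Laplacian polynomial of $G$ is $\Delta_G(x)=\det(\delta-A)\in\mathbb Z[x^{\pm1}]$, where $A_{ij}$ is the sum of the monomials $\sigma_e x^{k}$ over all edges $e$ of $G$ joining $v_{i,0}$ to $v_{j,k}$, and $\delta$ is the diagonal matrix whose entry $\delta_{ii}$ is the sum of the signs of the edges at $v_{i,0}$; loops of $\overline G$ contribute two inverse monomials to $A_{ii}$ and count twice in $\delta_{ii}$. Let $\overline\ell$ be the link in the solid torus $V=\mathbb A\times[0,1]$ with the diagram in $\mathbb A$ that is obtained from $\overline G$ by the medial construction: each edge of $\overline G$ is replaced by two strands that run parallel to it on its two sides and cross once at its middle,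 the over/under information at this crossing being determined by the sign of the edge, and the strands are joined around the vertices without further crossings. Embed $V$ as an unknotted solid torus in $S^3$, let $C$ be a meridian of $V$ encircling $V$ and let $\hat\ell=\overline\ell\cup C$ be the encircled link, with any orientation of $\overline\ell$. Let $\Delta_{\hat\ell}(t_1,\dots,t_\mu,x)$ be its multivariable Alexander polynomial, that is, a greatest common divisor of the first elementary ideal of the Alexander matrix of the Wirtinger presentation of the link group (well defined up to units of $\mathbb Z[t_1^{\pm1},\dots,t_\mu^{\pm1},x^{\pm1}]$), where the meridians of the components of $\overline\ell$ are mapped to $t_1,\dots,t_\mu$ and those of $C$ to $x$. Then $$\Delta_G(x)\ \doteq\ (x-1)\,\Delta_{\hat\ell}(-1,\dots,-1,x),$$ where $\doteq$ means equality up to multiplication by a unit of $\mathbb Z[x^{\pm1}]$. -/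

import Mathlib

open scoped LaurentPolynomial

noncomputable section

/-! ### Periodic graphs and their Laplacian polynomials -/

/-- A signed 1-periodic graph, given by its finitely many vertex orbits `V` and edge orbits `E`
(both taken finite below) under the free `ℤ`-action.
The graph itself has vertices `v_{i,n}` and edges `e_{j,n}` (`i : V`, `j : E`, `n : ℤ`), where
`e_{j,n}` has sign `sign j` and joins `v_{src j, n}` to `v_{tgt j, n + shift j}`, and `x` acts by
adding `1` to the second index. Loops and multiple edges are allowed, isolated vertices are not. -/
structure PeriodicGraph (V E : Type*) where
  src : E → V
  tgt : E → V
  shift : E → ℤ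
  sign : E → ℤˣ
  not_isolated : ∀ v, ∃ e, src e = v ∨ tgt e = v

/-- The reverse of a directed edge; `(e, true)` is the edge `e` directed from `src e` to `tgt e`,
and `(e, false)` is the same edge directed backwards. -/
def Dart.rev {E : Type*} (d : E × Bool) : E × Bool := (d.1, !d.2)

theorem Dart.rev_rev {E : Type*} (d : E × Bool) : Dart.rev (Dart.rev d) = d := by simp [Dart.rev]

namespace PeriodicGraph

variable {V E : Type*} (G : PeriodicGraph V E)

/-- Initial vertex of a directed edge of the quotient graph. -/
def start (d : E × Bool) : V := if d.2 then G.src d.1 else G.tgt d.1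

/-- The directed edge `d` of the quotient lifts to an edge from `v_{start d, 0}` to
`v_{start (rev d), dartShift d}`. -/
def dartShift (d : E × Bool) : ℤ := if d.2 then G.shift d.1 else -G.shift d.1

open Classical in
/-- The adjacency matrix over `ℤ[x, x⁻¹]`: the entry at `(i, j)` is the sum of `σ_e xⁿ` over all
edges `e` between `v_{i,0}` and `v_{j,n}`, a loop contributing two inverse monomials. -/
def adjacencyMatrix [Fintype E] : Matrix V V ℤ[T;T⁻¹] :=
  Matrix.of fun i j => ∑ d : E × Bool,
    if G.start d = i ∧ G.start (Dart.rev d) = j then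
      LaurentPolynomial.C (G.sign d.1 : ℤ) * LaurentPolynomial.T (G.dartShift d)
    else 0

open Classical in
/-- The signed degree matrix, loops counted twice. -/
def degreeMatrix [Fintype E] : Matrix V V ℤ[T;T⁻¹] :=
  Matrix.diagonal fun i => ∑ d : E × Bool,
    if G.start d = i then LaurentPolynomial.C (G.sign d.1 : ℤ) else 0

def laplacianMatrix [Fintype E] : Matrix V V ℤ[T;T⁻¹] := G.degreeMatrix - G.adjacencyMatrix

open Classical in
def laplacianPolynomial [Fintype V] [Fintype E] : ℤ[T;T⁻¹] := G.laplacianMatrix.det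

/-- The simple graph underlying the quotient graph (used to count its components). -/
def quotientGraph : SimpleGraph V :=
  SimpleGraph.fromRel fun u v => ∃ e, G.src e = u ∧ G.tgt e = v

end PeriodicGraph

/-! ### Plane periodic graphs: embeddings of the quotient graph in the annulus -/

/-- A plane 1-periodic graph: an embedding (up to homeomorphism) of the quotient graph in the open
annulus `(0,1) × S¹`, i.e. in the sphere minus two points, recorded combinatorially, with a radial
arc `γ` from the inner end of the annulus to the outer end. The plane graph is the preimage in the
strip `(0,1) × ℝ`, and the lifts of `γ` bound the fundamental domains of the `ℤ`-action.

`rot d` is the directed edge following `d` counterclockwise around its initial vertex.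
`R` is the set of regions (the components of the complement of the quotient graph in the sphere)
and `left d` is the region to the left of `d`; the corner between `d` and `rot d` lies both to the
left of `d` and to the right of `rot d`. The quotient graph may be disconnected, so a region may
have several boundary walks.
Planarity is Euler's formula `#vertices - #edges + #regions = 1 + #components`, together with the
connectedness of the sphere (the incidence graph of vertices and regions is connected).

The arc `γ` passes in succession through the distinct regions `path 0, …, path k` and, between
`path i` and `path (i+1)`, crosses the edge of `cut i` once, from the left of `cut i` to its right.
The inner and the outer end of the annulus lie in `path 0` and in `path k`.
The vertex `v_{i,0}` lies in the fundamental domain number `level i`, so that `level` and `shift`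
count the signed crossings of an edge with the lifts of `γ`. -/
structure AnnularEmbedding {V E : Type*} [Fintype V] [Fintype E] (G : PeriodicGraph V E)
    (R : Type*) [Fintype R] where
  rot : Equiv.Perm (E × Bool)
  start_rot : ∀ d, G.start (rot d) = G.start d
  sameCycle_rot : ∀ d d', G.start d = G.start d' → rot.SameCycle d d'
  left : E × Bool → R
  left_surjective : Function.Surjective left
  left_corner : ∀ d, left d = left (Dart.rev (rot d))
  connected : (SimpleGraph.fromRel fun a b : V ⊕ R =>
    ∃ d, a = Sum.inl (G.start d) ∧ b = Sum.inr (left d)).Connected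
  euler : Fintype.card V + Fintype.card R =
    Fintype.card E + 1 + Nat.card G.quotientGraph.ConnectedComponent
  k : ℕ
  cut : Fin k → E × Bool
  path : Fin (k + 1) → R
  path_injective : Function.Injective path
  left_cut : ∀ i, left (cut i) = path i.castSucc
  right_cut : ∀ i, left (Dart.rev (cut i)) = path i.succ
  level : V → ℤ
  shift_eq : ∀ e, G.shift e + level (G.tgt e) - level (G.src e) =
    (Nat.card {i // cut i = (e, true)} : ℤ) - Nat.card {i // cut i = (e, false)}

/-! ### Oriented link diagrams and the multivariable Alexander polynomial -/

/-- The combinatorial data of a diagram of an oriented link that enter the Wirtinger presentation.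
The closed curves of the diagram are cut at all crossings, and possibly at further points, into
segments. `next s` is the segment that follows `s` along the orientation. At a crossing `c`
the overpassing strand goes from the segment `overIn c` to `next (overIn c)` and the underpassing
strand from `underIn c` to `next (underIn c)`; `sign c` is the usual sign of the crossing. -/
structure LinkDiagram (S X : Type*) where
  next : S → S
  overIn : X → S
  underIn : X → S
  sign : X → ℤˣ
  next_injective : Function.Injective next
  pass_injective : Function.Injective (Sum.elim overIn underIn)

/-- `ℤ[t_c^{±1} : c ∈ K]`, the group ring of the free abelian group on `K`. -/
abbrev MvLaurent (K : Type*) := AddMonoidAlgebra ℤ (K →₀ ℤ)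

namespace MvLaurent

/-- The variable `t_c`, as a unit. -/
def var {K : Type*} (c : K) : (MvLaurent K)ˣ where
  val := AddMonoidAlgebra.single (Finsupp.single c 1) 1
  inv := AddMonoidAlgebra.single (Finsupp.single c (-1)) 1
  val_inv := by
    rw [AddMonoidAlgebra.single_mul_single, ← Finsupp.single_add, AddMonoidAlgebra.one_def]; simp
  inv_val := by
    rw [AddMonoidAlgebra.single_mul_single, ← Finsupp.single_add, AddMonoidAlgebra.one_def]; simp

/-- Evaluation of a Laurent polynomial at `t_c = u c`. -/
def eval {K A : Type*} [CommRing A] (u : K → Aˣ) : MvLaurent K →+* A :=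
  AddMonoidAlgebra.liftNCRingHom (Int.castRingHom A)
    ((Units.coeHom A).comp (AddMonoidHom.toMultiplicativeLeft
      (Finsupp.liftAddHom fun c => zmultiplesHom (Additive Aˣ) (Additive.ofMul (u c)))))
    fun _ _ => Commute.all _ _

theorem eval_var {K A : Type*} [CommRing A] (u : K → Aˣ) (c : K) :
    eval u (var c : MvLaurent K) = u c := by
  simp [eval, var]

end MvLaurent

open Classical in
/-- The Fox derivative with respect to the generator `j` of a word in the generators `α` and their
inverses (`(a, true)` is `a` and `(a, false)` is `a⁻¹`), mapped to `A` by `a ↦ t a`: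
`∂(a w) = ∂a + a ∂w` and `∂(a⁻¹ w) = -a⁻¹ ∂a + a⁻¹ ∂w`. -/
def foxDerivative {α A : Type*} [CommRing A] (t : α → Aˣ) (j : α) : List (α × Bool) → A
  | [] => 0
  | (a, true) :: w => (if a = j then 1 else 0) + (t a : A) * foxDerivative t j w
  | (a, false) :: w => ((t a)⁻¹ : Aˣ) * (foxDerivative t j w - if a = j then 1 else 0)

namespace LinkDiagram

variable {S X : Type*} (D : LinkDiagram S X)

/-- The components of the link. -/
def Component : Type _ := Quot fun s s' : S => D.next s = s'

/-- The arcs of the diagram: consecutive segments belong to the same arc unless they are separated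
by an undercrossing. -/
def Arc : Type _ := Quot fun s s' : S => D.next s = s' ∧ s ∉ Set.range D.underIn

def arc (s : S) : D.Arc := Quot.mk _ s

def arcComponent : D.Arc → D.Component := Quot.map id fun _ _ h => h.1

/-- The Wirtinger relator of a crossing, `o⁻¹ i o u⁻¹` or `o i o⁻¹ u⁻¹` according to its sign, where
`o` is the overcrossing arc and `i`, `u` are the incoming and outgoing undercrossing arcs. -/
def wirtingerRelator (c : X) : List (D.Arc × Bool) :=
  let o := D.arc (D.overIn c)
  let i := D.arc (D.underIn c)
  let u := D.arc (D.next (D.underIn c))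
  if D.sign c = 1 then [(o, false), (i, true), (o, true), (u, false)]
  else [(o, true), (i, true), (o, false), (u, false)]

/-- The Alexander matrix of the Wirtinger presentation: the meridians of the component `c` are
mapped to `t_c`. -/
def alexanderMatrix : Matrix X D.Arc (MvLaurent D.Component) :=
  Matrix.of fun c j =>
    foxDerivative (fun a => MvLaurent.var (D.arcComponent a)) j (D.wirtingerRelator c)

open Classical in
/-- The minor of the Alexander matrix on all columns but `j` and on the rows `f`. -/
def alexanderMinor [Fintype S] (j : D.Arc) (f : {a : D.Arc // a ≠ j} → X) :
    MvLaurent D.Component :=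
  letI : Finite D.Arc := inferInstanceAs (Finite (Quot _))
  letI : Fintype {a : D.Arc // a ≠ j} := Fintype.ofFinite _
  (Matrix.of fun a b : {a : D.Arc // a ≠ j} => D.alexanderMatrix (f a) b.1).det

/-- The first elementary ideal, generated by the minors of size (number of arcs) - 1. -/
def elementaryIdeal [Fintype S] : Ideal (MvLaurent D.Component) :=
  Ideal.span {p | ∃ j f, p = D.alexanderMinor j f}

/-- `Δ` is a multivariable Alexander polynomial of the link: a greatest common divisor of the first
elementary ideal (unique up to units). -/
def IsAlexanderPolynomial [Fintype S] (Δ : MvLaurent D.Component) : Prop :=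
  ∀ δ, δ ∣ Δ ↔ ∀ p ∈ D.elementaryIdeal, δ ∣ p

end LinkDiagram

/-! ### The encircled medial link -/

namespace AnnularEmbedding

variable {V E R : Type*} [Fintype V] [Fintype E] [Fintype R] {G : PeriodicGraph V E}
  (P : AnnularEmbedding G R)

/-- In the medial diagram every corner (between `d` and `rot d`, named by `d`) carries a strand that
joins the crossing in the middle of the edge of `d` to the crossing in the middle of the edge of
`rot d`. At the crossing of the edge `e`, directed as `d`, the strand of the corner `d` goes straight
on to the strand of the corner `rev d` (the first strand at `e`), and the strand of the corner
`rot⁻¹ d` goes straight on to the strand of the corner `rot⁻¹ (rev d)` (the second strand at `e`).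

An orientation of the medial link says of every corner `d` whether its strand is directed from the
edge of `d` to the edge of `rot d` (`true`) or backwards (`false`), consistently at all crossings. -/
structure Orientation where
  dir : E × Bool → Bool
  dir_first : ∀ d, dir (Dart.rev d) = !dir d
  dir_second : ∀ d, dir (P.rot.symm (Dart.rev d)) = !dir (P.rot.symm d)

/-- Segments of the diagram of the encircled link.

The circle `C` runs along `γ` on both sides of it: `front` is parallel to `γ` and passes over all
strands of the medial link, `back` is antiparallel to `γ` and passes under all strands. Both
parallels meet `2k` strands and are cut there into `2k + 1` segments, numbered in the direction
of `γ`.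

The arc `γ` crosses the edge of `d = cut i` between the initial vertex of `d` and the middle of the
edge. So it first meets the strand of the corner `d`, near the crossing of the edge of `d`, and then
the strand of the corner `rot⁻¹ d`, near the crossing of the edge of `d`. The front parallel is on
the side of the initial vertex of `d`, the back parallel on the side of the crossing.
The strand of every corner `d` is cut into five segments, numbered from `0` (at the edge of
`d`) to `4` (at the edge of `rot d`): if `γ` crosses the strand near the edge of `d`, then `back` and
`front` separate `0`, `1` and `1`, `2`, respectively; if it does so near the edge of `rot d`, then
`front` and `back` separate `2`, `3` and `3`, `4`, respectively. -/
inductive Segment (P : AnnularEmbedding G R) : Type _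
  | strand (d : E × Bool) (j : Fin 5)
  | front (j : Fin (2 * P.k + 1))
  | back (j : Fin (2 * P.k + 1))

/-- Segments are finite in number. -/
def segmentEquiv :
    ((E × Bool) × Fin 5) ⊕ (Fin (2 * P.k + 1) ⊕ Fin (2 * P.k + 1)) ≃ P.Segment where
  toFun
    | Sum.inl (d, j) => .strand d j
    | Sum.inr (Sum.inl j) => .front j
    | Sum.inr (Sum.inr j) => .back j
  invFun
    | .strand d j => Sum.inl (d, j)
    | .front j => Sum.inr (Sum.inl j)
    | .back j => Sum.inr (Sum.inr j)
  left_inv := by rintro (_ | _ | _) <;> rfl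
  right_inv := by rintro (_ | _ | _) <;> rfl

instance : Fintype P.Segment := Fintype.ofEquiv _ P.segmentEquiv

/-- Crossings of the diagram of the encircled link: one in the middle of every edge, and four for
each crossing of `γ` with an edge. -/
inductive Crossing (P : AnnularEmbedding G R) : Type _
  | edge (e : E)
  | firstFront (i : Fin P.k)
  | firstBack (i : Fin P.k)
  | secondFront (i : Fin P.k)
  | secondBack (i : Fin P.k)

variable {P} (o : P.Orientation)

/-- The successor of a segment. Strands go straight on at the crossings in the middle of the edges;
`front` and `back` are joined to each other at both ends. -/
def nextSegment : P.Segment → P.Segment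
  | .strand d j =>
    if o.dir d then
      if h : (j : ℕ) < 4 then .strand d ⟨j + 1, by omega⟩
      else .strand (P.rot.symm (Dart.rev (P.rot d))) 4
    else
      if (j : ℕ) = 0 then .strand (Dart.rev d) 0 else .strand d ⟨j - 1, by omega⟩
  | .front j => if h : (j : ℕ) < 2 * P.k then .front ⟨j + 1, by omega⟩ else .back j
  | .back j => if (j : ℕ) = 0 then .front j else .back ⟨j - 1, by omega⟩

/-- The incoming segment of the first strand at the crossing of the edge `e`. -/
def firstIn (e : E) : P.Segment :=
  .strand (if o.dir (e, true) then (e, false) else (e, true)) 0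

/-- The incoming segment of the second strand at the crossing of the edge `e`. -/
def secondIn (e : E) : P.Segment :=
  .strand (P.rot.symm (if o.dir (P.rot.symm (e, true)) then (e, true) else (e, false))) 4

/-- The incoming segment of the overcrossing strand. The first strand passes over at the positive
edges and the second strand at the negative edges. -/
def overSegment : P.Crossing → P.Segment
  | .edge e => if G.sign e = 1 then firstIn o e else secondIn o e
  | .firstFront i => .front ⟨2 * i, by omega⟩
  | .firstBack i => .strand (P.cut i) (if o.dir (P.cut i) then 0 else 1)
  | .secondFront i => .front ⟨2 * i + 1, by omega⟩
  | .secondBack i =>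
    .strand (P.rot.symm (P.cut i)) (if o.dir (P.rot.symm (P.cut i)) then 3 else 4)

/-- The incoming segment of the undercrossing strand. -/
def underSegment : P.Crossing → P.Segment
  | .edge e => if G.sign e = 1 then secondIn o e else firstIn o e
  | .firstFront i => .strand (P.cut i) (if o.dir (P.cut i) then 1 else 2)
  | .firstBack i => .back ⟨2 * i + 1, by omega⟩
  | .secondFront i =>
    .strand (P.rot.symm (P.cut i)) (if o.dir (P.rot.symm (P.cut i)) then 2 else 3)
  | .secondBack i => .back ⟨2 * i + 2, by omega⟩

/-- The sign of a crossing. The crossing of two oriented strands is positive if the overpassing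
strand has to be turned counterclockwise by less than `π` to agree with the underpassing one. -/
def crossingSign : P.Crossing → ℤˣ
  | .edge e =>
    G.sign e * (if o.dir (e, true) then -1 else 1) *
      (if o.dir (P.rot.symm (e, true)) then 1 else -1)
  | .firstFront i => if o.dir (P.cut i) then -1 else 1
  | .firstBack i => if o.dir (P.cut i) then -1 else 1
  | .secondFront i => if o.dir (P.rot.symm (P.cut i)) then 1 else -1
  | .secondBack i => if o.dir (P.rot.symm (P.cut i)) then 1 else -1

theorem nextSegment_injective : Function.Injective (nextSegment o) := by
  have h2 : ∀ d, o.dir (P.rot.symm (Dart.rev (P.rot d))) = !o.dir d := fun d => by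
    simpa using o.dir_second (P.rot d)
  have hr : ∀ d d' : E × Bool, Dart.rev d = Dart.rev d' → d = d' := fun d d' h => by
    rw [← Dart.rev_rev d, h, Dart.rev_rev]
  have hd := o.dir_first
  rintro (⟨d, j⟩ | j | j) (⟨d', j'⟩ | j' | j') h <;> simp only [nextSegment] at h
  · have key : o.dir d = o.dir d' → d = d' ∧ j = j' := by
      intro hdd
      split_ifs at h <;> simp only [Segment.strand.injEq, Fin.ext_iff] at h <;>
        grind [P.rot.symm.injective.eq_iff, P.rot.injective.eq_iff]
    have : o.dir d = o.dir d' := by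
      by_contra hne
      split_ifs at h <;> simp only [Segment.strand.injEq, Fin.ext_iff] at h <;> grind
    obtain ⟨rfl, rfl⟩ := key this
    rfl
  all_goals
    split_ifs at h <;>
      simp_all only [Segment.front.injEq, Segment.back.injEq, Fin.ext_iff, reduceCtorEq] <;> grind

theorem cut_injective : Function.Injective P.cut := fun i i' h => by
  have := P.left_cut i
  rw [h, P.left_cut] at this
  simpa using (P.path_injective this).symm

set_option maxHeartbeats 2000000 in
theorem pass_injective :
    Function.Injective (Sum.elim (overSegment o) (underSegment o)) := by
  have hf : ∀ e, ∃ d, d.1 = e ∧ o.dir d = false ∧ firstIn o e = .strand d 0 := fun e => by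
    have := o.dir_first (e, true)
    by_cases h : o.dir (e, true)
    · exact ⟨(e, false), rfl, by simpa [Dart.rev, h] using this, by simp [firstIn, h]⟩
    · exact ⟨(e, true), rfl, by simpa using h, by simp [firstIn, h]⟩
  have hs : ∀ e, ∃ d, (P.rot d).1 = e ∧ o.dir d = true ∧ secondIn o e = .strand d 4 := fun e => by
    have := o.dir_second (e, true)
    by_cases h : o.dir (P.rot.symm (e, true))
    · exact ⟨P.rot.symm (e, true), by simp, h, by simp [secondIn, h]⟩
    · exact ⟨P.rot.symm (e, false), by simp, by simpa [Dart.rev, h] using this,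
        by simp [secondIn, h]⟩
  choose f hf1 hf2 hf3 using hf
  choose g hg1 hg2 hg3 using hs
  have hc := P.cut_injective
  have hc' : ∀ i i', P.rot.symm (P.cut i) = P.rot.symm (P.cut i') → i = i' := fun i i' h =>
    hc (P.rot.symm.injective h)
  rintro ((_ | _ | _ | _ | _) | (_ | _ | _ | _ | _))
    ((_ | _ | _ | _ | _) | (_ | _ | _ | _ | _)) h <;>
    simp only [Sum.elim_inl, Sum.elim_inr, overSegment, underSegment, hf3, hg3] at h <;>
    (try split_ifs at h) <;>
    simp only [Segment.strand.injEq, Segment.front.injEq, Segment.back.injEq, Fin.mk.injEq,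
      Fin.reduceEq, and_false, and_true, reduceCtorEq] at h <;>
    first
    | omega
    | (obtain rfl := hc h; first | rfl | contradiction)
    | (obtain rfl := hc' _ _ h; first | rfl | contradiction)
    | (simp_all; done)
    | grind

/-- The diagram of the encircled link: the medial link in the solid torus (annulus times interval),
together with a meridian `C` of that solid torus. -/
def encircledLink : LinkDiagram P.Segment P.Crossing where
  next := nextSegment o
  overIn := overSegment o
  underIn := underSegment o
  sign := crossingSign o
  next_injective := nextSegment_injective o
  pass_injective := pass_injective o

/-- The component `C` of the encircled link. -/
def circle : (encircledLink o).Component := Quot.mk _ (.front 0)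

open Classical in
/-- The substitution of `x` for the variable of `C` and of `-1` for all other variables. -/
def specialize : MvLaurent (encircledLink o).Component →+* ℤ[T;T⁻¹] :=
  MvLaurent.eval fun c =>
    if c = circle o then (LaurentPolynomial.isUnit_T (R := ℤ) 1).unit else -1

end AnnularEmbedding

end

/-!
Both sides are determinants: `Δ_G` by definition, and `(x - 1) Δ(-1, …, -1, x)` because the minor
of the Alexander matrix that omits an arc of `C` is `(x - 1)` times the Alexander polynomial. One
determinant divides another as soon as, in every module, each solution of the first homogeneous
system has its values in the span of the values of some solution of the second. So it is enough to
compare solutions.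

At `t = -1` the Wirtinger relation at a crossing of the medial link says that the values on the two
ends of the understrand add up to twice the value on the overstrand. With `C` colored by `0`, the
passages under `C` multiply values by `x`, so a solution is a coloring of the corners between
consecutive edges at the vertices, twisted by `x` along the path `γ` that cuts the annulus open.
By Euler's formula the annulus has no other topology, so the coloring splits as a function `w` of
the vertex plus a function of the region. The relations at the crossings then say that the jump
of the region part across an edge is, up to sign and powers of `x`, the jump of `w` along it.
Around a vertex the jumps of the region part sum to `0`, which is the equation `(δ - A) w = 0`.
Conversely such a `w` determines the jumps of a region part, and with it a coloring.
-/

noncomputable section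

/-! ### Linear systems, abelian groups and permutations -/

section LinearSystems

variable {A : Type*} [CommRing A]

/-- `w` solves the homogeneous linear system with coefficient matrix `N`. The unknowns take values
in an arbitrary module `W`, so that these solutions are the homomorphisms to `W` from the module
presented by `N`. -/
def IsSolution {k n W : Type*} [Fintype n] [AddCommGroup W] [Module A W] (N : Matrix k n A)
    (w : n → W) : Prop :=
  ∀ i, ∑ j, N i j • w j = 0

theorem det_dvd_det_of_mul_eq_mul {n k : Type*} [Fintype n] [DecidableEq n] [Fintype k]
    [DecidableEq k] {L Y : Matrix n n A} {N : Matrix k k A} {X M : Matrix k n A} {Q : Matrix n k A}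
    (hX : X * L = N * M) (hY : Y * L = 1 - Q * M) : L.det ∣ N.det := by
  have key : Matrix.fromBlocks N X (-Q) Y * Matrix.fromBlocks 1 (-M) 0 L =
      Matrix.fromBlocks N 0 (-Q) 1 := by
    simp [Matrix.fromBlocks_multiply, hX, hY]
  have hdet := congrArg Matrix.det key
  rw [Matrix.det_mul, Matrix.det_fromBlocks_zero₂₁, Matrix.det_fromBlocks_zero₁₂, Matrix.det_one,
    Matrix.det_one, one_mul, mul_one] at hdet
  exact ⟨_, by rw [← hdet, mul_comm]⟩

theorem mkQ_eq_mkQ_iff_exists_vecMul {k n : Type*} [Fintype k] (L : Matrix k n A)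
    (v w : n → A) :
    (Submodule.span A (Set.range L.row)).mkQ v = (Submodule.span A (Set.range L.row)).mkQ w ↔
      ∃ y : k → A, Matrix.vecMul y L = v - w := by
  rw [← sub_eq_zero, ← map_sub, Submodule.mkQ_apply, Submodule.Quotient.mk_eq_zero,
    Submodule.mem_span_range_iff_exists_fun]
  simp only [Matrix.vecMul_eq_sum]
  rfl

universe u₁ u₂

/-- Apply the hypothesis to the universal solution `e`, in the module presented by `L`. -/
theorem det_dvd_det_of_forall_isSolution {A : Type u₁} [CommRing A] {n : Type u₂} {k : Type*}
    [Fintype n] [DecidableEq n] [Fintype k] [DecidableEq k] (L : Matrix n n A) (N : Matrix k k A)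
    (h : ∀ (W : Type (max u₁ u₂)) [AddCommGroup W] [Module A W] (e : n → W), IsSolution L e →
      ∃ m : k → W, IsSolution N m ∧ ∀ i, e i ∈ Submodule.span A (Set.range m)) :
    L.det ∣ N.det := by
  let K : Submodule A (n → A) := Submodule.span A (Set.range L.row)
  have hlift (v : n → A) : ∑ j, v j • K.mkQ (Pi.single j 1) = K.mkQ v := by
    simp_rw [← map_smul, ← map_sum]
    congr 1
    ext i
    simp [Finset.sum_apply, Pi.single_apply]
  obtain ⟨m, hm, hspan⟩ := h ((n → A) ⧸ K) (fun j => K.mkQ (Pi.single j 1)) fun i => by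
    rw [hlift, Submodule.mkQ_apply, Submodule.Quotient.mk_eq_zero]
    exact Submodule.subset_span ⟨i, rfl⟩
  choose M hM using fun j => K.mkQ_surjective (m j)
  choose Q hQ using fun i => (Submodule.mem_span_range_iff_exists_fun A).1 (hspan i)
  have hrows (r : k → A) : ∑ j, r j • m j = K.mkQ (Matrix.vecMul r (Matrix.of M)) := by
    rw [Matrix.vecMul_eq_sum, map_sum]
    exact Finset.sum_congr rfl fun j _ => by rw [← hM, ← map_smul]; rfl
  choose X hX using fun i => (mkQ_eq_mkQ_iff_exists_vecMul L
    (Matrix.vecMul (N i) (Matrix.of M)) 0).1 (by rw [map_zero, ← hrows]; exact hm i)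
  choose Y hY using fun i => (mkQ_eq_mkQ_iff_exists_vecMul L (Pi.single i 1)
    (Matrix.vecMul (Q i) (Matrix.of M))).1 (by rw [← hrows, hQ])
  refine det_dvd_det_of_mul_eq_mul (X := Matrix.of X) (Y := Matrix.of Y) (Q := Matrix.of Q)
    (M := Matrix.of M) ?_ ?_
  · funext i
    rw [Matrix.mul_apply_eq_vecMul, Matrix.mul_apply_eq_vecMul]
    exact (hX i).trans (sub_zero _)
  · funext i
    rw [Matrix.mul_apply_eq_vecMul]
    refine (hY i).trans (funext fun j => ?_)
    rw [Pi.sub_apply, Matrix.sub_apply, Matrix.mul_apply_eq_vecMul, Matrix.one_apply,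
      Pi.single_apply]
    simp only [eq_comm]
    rfl

theorem mul_det_updateCol_eq_neg_mul_det {m : Type*} [Fintype m] [DecidableEq m]
    {M : Matrix m m A} {u : m → A} {r : A} {v : m → A} (j : m)
    (h : ∀ i, u i * r + ∑ b, M i b * v b = 0) : r * (M.updateCol j u).det = -(v j * M.det) := by
  have hcol : r • u = fun i => ∑ b, -v b • M i b := by
    funext i
    simp only [Pi.smul_apply, smul_eq_mul, neg_mul, Finset.sum_neg_distrib, mul_comm (v _)]
    linear_combination h i
  calc r * (M.updateCol j u).det = (M.updateCol j (r • u)).det :=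
        (Matrix.det_updateCol_smul ..).symm
    _ = -v j • M.det := by rw [hcol]; exact Matrix.det_updateCol_sum M j fun b => -v b
    _ = -(v j * M.det) := neg_mul _ _

end LinearSystems

section DivisibleModuloSubgroup

variable {M : Type*} [AddCommGroup M]

theorem exists_natCast_smul_of_forall_prime {Q : Submodule ℤ M}
    (h : ∀ p : ℕ, p.Prime → ∀ x ∈ Q, ∃ y ∈ Q, x = (p : ℤ) • y) (n : ℕ) :
    n ≠ 0 → ∀ x ∈ Q, ∃ y ∈ Q, x = (n : ℤ) • y := by
  induction n using Nat.recOnMul with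
  | zero => intro h0; exact absurd rfl h0
  | one => exact fun _ x hx => ⟨x, hx, by simp⟩
  | prime p hp => exact fun _ => h p hp
  | mul a b ha hb =>
    intro hab x hx
    obtain ⟨y, hy, rfl⟩ := ha (left_ne_zero_of_mul hab) x hx
    obtain ⟨z, hz, rfl⟩ := hb (right_ne_zero_of_mul hab) y hy
    exact ⟨z, hz, by rw [smul_smul, Nat.cast_mul]⟩

/-- By Nakayama's lemma for the ideal `(2)`, an odd number `r` annihilates `Q`, which is divisible
by `r`. -/
theorem eq_bot_of_fg_of_forall_prime {Q : Submodule ℤ M} (hQ : Q.FG)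
    (h : ∀ p : ℕ, p.Prime → ∀ x ∈ Q, ∃ y ∈ Q, x = (p : ℤ) • y) : Q = ⊥ := by
  obtain ⟨r, hr, hrQ⟩ := Submodule.exists_sub_one_mem_and_smul_eq_zero_of_fg_of_le_smul
    (Ideal.span {(2 : ℤ)}) Q hQ fun x hx => by
      obtain ⟨y, hy, rfl⟩ := h 2 Nat.prime_two x hx
      exact Submodule.smul_mem_smul (Ideal.subset_span rfl) hy
  have hr0 : r ≠ 0 := by
    rintro rfl
    rw [Ideal.mem_span_singleton] at hr
    norm_num at hr
  refine (Submodule.eq_bot_iff _).2 fun x hx => ?_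
  obtain ⟨y, hy, rfl⟩ :=
    exists_natCast_smul_of_forall_prime h r.natAbs (Int.natAbs_ne_zero.2 hr0) x hx
  rcases Int.natAbs_eq r with hnat | hnat
  · rw [← hnat, hrQ y hy]
  · rw [show (r.natAbs : ℤ) = -r by lia, neg_smul, hrQ y hy, neg_zero]

theorem le_of_fg_of_forall_prime {N B : Submodule ℤ M} (hN : N.FG)
    (h : ∀ p : ℕ, p.Prime → ∀ z ∈ N, ∃ b ∈ B, ∃ z' ∈ N, z = b + (p : ℤ) • z') : N ≤ B := by
  suffices N.map B.mkQ = ⊥ by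
    simpa [← LinearMap.le_ker_iff_map] using this
  refine eq_bot_of_fg_of_forall_prime (hN.map _) ?_
  rintro p hp _ ⟨z, hz, rfl⟩
  obtain ⟨b, hb, z', hz', rfl⟩ := h p hp z hz
  refine ⟨_, ⟨z', hz', rfl⟩, ?_⟩
  rw [map_add, map_smul, B.mkQ_apply b, (Submodule.Quotient.mk_eq_zero B).2 hb, zero_add]

end DivisibleModuloSubgroup

section Permutations

variable {α : Type*}

/-- The set `T` consists of the elements that are met on the way from `φ a` to `b`. -/
theorem exists_set_of_sameCycle [Finite α] {φ : Equiv.Perm α} {a b : α}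
    (h : φ.SameCycle a b) (hab : a ≠ b) :
    ∃ T : Set α, b ∈ T ∧ φ b ∉ T ∧ a ∉ T ∧ φ a ∈ T ∧
      ∀ d, d ≠ a → d ≠ b → (φ d ∈ T ↔ d ∈ T) := by
  classical
  have hex : ∃ n : ℕ, (φ ^ n) a = b := h.exists_nat_pow_eq
  let m := Nat.find hex
  have hmb : (φ ^ m) a = b := Nat.find_spec hex
  have hmin : ∀ l < m, (φ ^ l) a ≠ b := fun l hl => Nat.find_min hex hl
  have hm0 : m ≠ 0 := fun h0 => hab (by rw [← hmb, h0]; rfl)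
  have hsucc : ∀ l, (φ ^ (l + 1)) a = φ ((φ ^ l) a) := fun l => by
    rw [pow_succ', Equiv.Perm.mul_apply]
  refine ⟨{d | ∃ l < m, (φ ^ (l + 1)) a = d}, ⟨m - 1, by lia, ?_⟩, ?_, ?_, ⟨0, by lia, by simp⟩,
    fun d hda hdb => ⟨?_, ?_⟩⟩
  · rwa [show m - 1 + 1 = m by lia]
  · rintro ⟨l, hl, hlb⟩
    exact hmin l hl (φ.injective (by rw [← hsucc, hlb]))
  · rintro ⟨l, hl, hla⟩
    apply hmin (m - (l + 1)) (by lia)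
    nth_rw 1 [← hla]
    rw [← Equiv.Perm.mul_apply, ← pow_add, show m - (l + 1) + (l + 1) = m by lia, hmb]
  · rintro ⟨_ | l, hl, hld⟩
    · exact absurd (φ.injective (by simpa using hld.symm)) hda
    · exact ⟨l, by lia, φ.injective (by rw [← hsucc, hld])⟩
  · rintro ⟨l, hl, rfl⟩
    rcases Nat.lt_or_ge (l + 1) m with hlm | hlm
    · exact ⟨l + 1, hlm, by rw [hsucc]⟩
    · exact absurd (by rw [show l + 1 = m by lia, hmb]) hdb

variable {W : Type*} [AddCommGroup W] (φ : Equiv.Perm α)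

/-- The coboundary of the cyclic graph of a permutation: it maps a function `m` to its differences
`m a - m (φ⁻¹ a)`. -/
def permDifference : (α → W) →+ (α → W) where
  toFun m a := m a - m (φ.symm a)
  map_zero' := by ext; simp
  map_add' m m' := by ext; simp; abel

open Classical in
theorem single_sub_single_mem_range_permDifference [Finite α] {a b : α} (h : φ.SameCycle a b)
    (w : W) :
    Pi.single a w - Pi.single b w ∈ (permDifference (W := W) φ).range := by
  obtain ⟨n, rfl⟩ := h.exists_nat_pow_eq
  clear h
  induction n with
  | zero => simp
  | succ n ih =>
    have hstep : Pi.single ((φ ^ n) a) w - Pi.single (φ ((φ ^ n) a)) w ∈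
        (permDifference (W := W) φ).range :=
      ⟨Pi.single ((φ ^ n) a) w, by
        ext b
        simp [permDifference, Pi.single_apply, Equiv.symm_apply_eq]⟩
    have := add_mem ih hstep
    rwa [sub_add_sub_cancel, ← Equiv.Perm.mul_apply, ← pow_succ'] at this

open Classical in
theorem exists_sub_eq_of_sum_eq_zero [Fintype α] {ι : Type*} (π : α → ι)
    (hφ : ∀ a b, π a = π b → φ.SameCycle a b) (F : α → W)
    (hF : ∀ i, ∑ a, (if π a = i then F a else 0) = 0) :
    ∃ m : α → W, ∀ a, m a - m (φ.symm a) = F a := by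
  suffices h : F ∈ (permDifference (W := W) φ).range by
    obtain ⟨m, hm⟩ := h
    exact ⟨m, congrFun hm⟩
  rcases isEmpty_or_nonempty α with hα | hα
  · exact ⟨0, Subsingleton.elim _ _⟩
  have hinv (a : α) : π (Function.invFun π (π a)) = π a := Function.invFun_eq ⟨a, rfl⟩
  have hfiber (i : ι) :
      ∑ a with π a = i, (Pi.single (Function.invFun π (π a)) (F a) : α → W) = 0 := by
    calc _ = ∑ a with π a = i, (Pi.single (Function.invFun π i) (F a) : α → W) :=
          Finset.sum_congr rfl fun a ha => by rw [(Finset.mem_filter.1 ha).2]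
      _ = Pi.single (Function.invFun π i) (∑ a with π a = i, F a) :=
          (map_sum (AddMonoidHom.single (fun _ : α => W) _) F _).symm
      _ = 0 := by rw [Finset.sum_filter, hF, Pi.single_zero]
  have hzero : ∑ a, (Pi.single (Function.invFun π (π a)) (F a) : α → W) = 0 := by
    rw [← Finset.sum_fiberwise_of_maps_to (t := Finset.univ.image π) (g := π)
      fun a _ => Finset.mem_image_of_mem _ (Finset.mem_univ a)]
    exact Finset.sum_eq_zero fun i _ => hfiber i
  have hsum : F = ∑ a, (Pi.single a (F a) - Pi.single (Function.invFun π (π a)) (F a)) := by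
    rw [Finset.sum_sub_distrib, hzero, sub_zero, Finset.univ_sum_single]
  rw [hsum]
  exact sum_mem fun a _ =>
    single_sub_single_mem_range_permDifference φ (hφ _ _ (hinv a).symm) _

end Permutations

/-! ### Laurent polynomials in several variables -/

namespace MvLaurent

variable {K : Type*}

/-- The monomial with exponents `g`, as a unit. -/
def monomial (g : K →₀ ℤ) : (MvLaurent K)ˣ :=
  (AddMonoidAlgebra.of ℤ (K →₀ ℤ)).toHomUnits (Multiplicative.ofAdd g)

theorem monomial_add (g h : K →₀ ℤ) : monomial (g + h) = monomial g * monomial h := by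
  simp [monomial, ofAdd_add]

theorem monomial_single (c : K) : monomial (Finsupp.single c 1) = (var c : (MvLaurent K)ˣ) := by
  ext; rfl

theorem ringHom_ext {A : Type*} [CommRing A] {f g : MvLaurent K →+* A}
    (h : ∀ c : K, f (var c : MvLaurent K) = g (var c : MvLaurent K)) : f = g := by
  let F (φ : MvLaurent K →+* A) : (K →₀ ℤ) →+ Additive Aˣ :=
    MonoidHom.toAdditiveRight
      ((Units.map φ.toMonoidHom).comp (AddMonoidAlgebra.of ℤ (K →₀ ℤ)).toHomUnits)
  have hF : F f = F g := by
    refine Finsupp.addHom_ext' fun c => AddMonoidHom.ext_int (Additive.toMul.injective ?_)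
    ext
    exact h c
  refine AddMonoidAlgebra.ringHom_ext (fun r => ?_) fun a => ?_
  · have : (AddMonoidAlgebra.single 0 r : MvLaurent K) = (r : MvLaurent K) := by
      simp [AddMonoidAlgebra.intCast_def]
    rw [this, map_intCast, map_intCast]
  · exact congrArg (fun x => ((Additive.toMul x : Aˣ) : A)) (DFunLike.congr_fun hF a)

theorem eval_eq_zero_of_dvd {A : Type*} [CommRing A] {u : K → Aˣ} {c : K} (hc : u c = 1)
    {p : MvLaurent K} (h : (var c : MvLaurent K) - 1 ∣ p) : eval u p = 0 := by
  obtain ⟨q, rfl⟩ := h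
  simp [eval_var, hc]

open Classical in
theorem var_sub_one_dvd_iff (c : K) (p : MvLaurent K) :
    (var c : MvLaurent K) - 1 ∣ p ↔ eval (fun k => if k = c then 1 else var k) p = 0 := by
  refine ⟨eval_eq_zero_of_dvd (by simp), fun h => ?_⟩
  let I : Ideal (MvLaurent K) := Ideal.span {(var c : MvLaurent K) - 1}
  have key : (Ideal.Quotient.mk I).comp (eval (fun k => if k = c then 1 else var k)) =
      Ideal.Quotient.mk I := by
    apply ringHom_ext
    intro k
    rw [RingHom.comp_apply, eval_var]
    split_ifs with hk
    · subst hk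
      rw [eq_comm, Ideal.Quotient.eq]
      exact Ideal.subset_span rfl
    · rfl
  have hp := DFunLike.congr_fun key p
  rw [RingHom.comp_apply, h, map_zero, eq_comm, Ideal.Quotient.eq_zero_iff_mem] at hp
  exact Ideal.mem_span_singleton.1 hp

theorem var_ne_one (c : K) : (var c : MvLaurent K) ≠ 1 := by
  intro h
  have h2 := congrArg (eval (fun _ => (-1 : ℤˣ))) h
  rw [eval_var, map_one] at h2
  norm_num at h2

theorem var_sub_one_ne_zero (c : K) : (var c : MvLaurent K) - 1 ≠ 0 :=
  sub_ne_zero.2 (var_ne_one c)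

theorem var_sub_one_dvd_of_dvd_mul {c c' : K} (hc : c ≠ c') {p : MvLaurent K}
    (h : (var c : MvLaurent K) - 1 ∣ ((var c' : MvLaurent K) - 1) * p) :
    (var c : MvLaurent K) - 1 ∣ p := by
  classical
  rw [var_sub_one_dvd_iff] at h ⊢
  rw [map_mul, map_sub, map_one, eval_var, if_neg hc.symm] at h
  exact (mul_eq_zero.1 h).resolve_left (var_sub_one_ne_zero c')

theorem dvd_of_dvd_var_sub_one_mul {c c' : K} (hc : c ≠ c') {δ p : MvLaurent K}
    (h : δ ∣ ((var c : MvLaurent K) - 1) * p) (h' : δ ∣ ((var c' : MvLaurent K) - 1) * p) :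
    δ ∣ p := by
  rcases eq_or_ne δ 0 with rfl | hδ
  · rw [zero_dvd_iff, mul_eq_zero] at h
    rw [h.resolve_left (var_sub_one_ne_zero c)]
  obtain ⟨α, hα⟩ := h
  obtain ⟨β, hβ⟩ := h'
  have hαβ : ((var c' : MvLaurent K) - 1) * α = ((var c : MvLaurent K) - 1) * β := by
    apply mul_left_cancel₀ hδ
    linear_combination ((var c : MvLaurent K) - 1) * hβ - ((var c' : MvLaurent K) - 1) * hα
  obtain ⟨α', rfl⟩ := var_sub_one_dvd_of_dvd_mul hc ⟨β, hαβ⟩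
  exact ⟨α', mul_left_cancel₀ (var_sub_one_ne_zero c) (by rw [hα]; ring)⟩

end MvLaurent

/-! ### The first elementary ideal of a link diagram -/

section FoxDerivative

variable {α A : Type*} [CommRing A] {t : α → Aˣ}

open Classical in
theorem mul_foxDerivative_inv_conj (j : α) {o i u : α} (h : t u = t i) :
    (t o : A) * foxDerivative t j [(o, false), (i, true), (o, true), (u, false)] =
      (t i - 1) * (if o = j then 1 else 0) + (if i = j then 1 else 0) -
        t o * (if u = j then 1 else 0) := by
  simp only [foxDerivative, h, zero_sub]
  generalize (if o = j then (1 : A) else 0) = o'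
  generalize (if u = j then (1 : A) else 0) = u'
  linear_combination ((-o' + (if i = j then 1 else 0) + t i * (o' - t o * (t i)⁻¹.val * u'))) *
    (t o).mul_inv - t o * u' * (t i).mul_inv

open Classical in
theorem foxDerivative_conj (j : α) {o i u : α} (h : t u = t i) :
    foxDerivative t j [(o, true), (i, true), (o, false), (u, false)] =
      (1 - t i : A) * (if o = j then 1 else 0) + t o * (if i = j then 1 else 0) -
        (if u = j then 1 else 0) := by
  simp only [foxDerivative, h, zero_sub]
  generalize (if o = j then (1 : A) else 0) = o'
  generalize (if u = j then (1 : A) else 0) = u'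
  linear_combination t i * (-o' - (t i)⁻¹.val * u') * (t o).mul_inv - u' * (t i).mul_inv

end FoxDerivative

namespace LinkDiagram

variable {S X : Type*} (D : LinkDiagram S X)

instance [Finite S] : Finite D.Arc := inferInstanceAs (Finite (Quot _))

/-- The component of the link that contains a given segment. -/
def component (s : S) : D.Component := Quot.mk _ s

theorem component_next (s : S) : D.component (D.next s) = D.component s :=
  (Quot.sound (r := fun s s' : S => D.next s = s') rfl).symm

theorem arcComponent_arc (s : S) : D.arcComponent (D.arc s) = D.component s := rfl

theorem arc_next {s : S} (h : s ∉ Set.range D.underIn) : D.arc (D.next s) = D.arc s :=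
  (Quot.sound ⟨rfl, h⟩).symm

theorem underIn_injective : Function.Injective D.underIn :=
  D.pass_injective.comp Sum.inr_injective

theorem overIn_notMem_range_underIn (c : X) : D.overIn c ∉ Set.range D.underIn :=
  fun ⟨c', hc'⟩ => by simpa using D.pass_injective (a₁ := Sum.inr c') (a₂ := Sum.inl c) hc'

/-- The variable of the component of a segment: the image of the meridian of the segment in the
group ring. -/
def meridian (s : S) : (MvLaurent D.Component)ˣ := MvLaurent.var (D.component s)

theorem meridian_next (s : S) : D.meridian (D.next s) = D.meridian s :=
  congrArg MvLaurent.var (D.component_next s)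

open Classical in
/-- The segment of the underpassing strand on the right of the overpassing strand. -/
def underRight (c : X) : S := if D.sign c = 1 then D.underIn c else D.next (D.underIn c)

open Classical in
/-- The segment of the underpassing strand on the left of the overpassing strand. -/
def underLeft (c : X) : S := if D.sign c = 1 then D.next (D.underIn c) else D.underIn c

open Classical in
/-- The factor that brings the row of a crossing in the Alexander matrix to a form that does not
depend on the sign of the crossing. -/
def rowUnit (c : X) : (MvLaurent D.Component)ˣ :=
  if D.sign c = 1 then D.meridian (D.overIn c) else -1

open Classical in
theorem rowUnit_smul_row_alexanderMatrix (c : X) :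
    (D.rowUnit c : MvLaurent D.Component) • D.alexanderMatrix.row c =
      ((D.meridian (D.underIn c) : MvLaurent D.Component) - 1) • Pi.single (D.arc (D.overIn c)) 1 +
        Pi.single (D.arc (D.underRight c)) 1 -
        (D.meridian (D.overIn c) : MvLaurent D.Component) •
          Pi.single (D.arc (D.underLeft c)) 1 := by
  have hout : MvLaurent.var (D.arcComponent (D.arc (D.next (D.underIn c)))) =
      MvLaurent.var (D.arcComponent (D.arc (D.underIn c))) := D.meridian_next _
  have hrow (j : D.Arc) : D.alexanderMatrix.row c j = foxDerivative
      (fun a => MvLaurent.var (D.arcComponent a)) j (D.wirtingerRelator c) := rfl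
  ext j : 1
  by_cases hc : D.sign c = 1
  · have := mul_foxDerivative_inv_conj (t := fun a => MvLaurent.var (D.arcComponent a)) j
      (o := D.arc (D.overIn c)) hout
    simp only [Pi.add_apply, Pi.sub_apply, Pi.smul_apply, smul_eq_mul, hrow, rowUnit,
      wirtingerRelator, underRight, underLeft, hc, if_true, Pi.single_apply, eq_comm (a := j)]
    exact this
  · have := foxDerivative_conj (t := fun a => MvLaurent.var (D.arcComponent a)) j
      (o := D.arc (D.overIn c)) hout
    simp only [Pi.add_apply, Pi.sub_apply, Pi.smul_apply, smul_eq_mul, hrow, rowUnit,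
      wirtingerRelator, underRight, underLeft, hc, if_false, Pi.single_apply, eq_comm (a := j),
      this, Units.val_neg, Units.val_one]
    simp only [meridian, arcComponent_arc]
    ring

section Solutions

variable [Fintype D.Arc] {A W : Type*} [CommRing A] [AddCommGroup W] [Module A W]
  (φ : MvLaurent D.Component →+* A)

theorem rowUnit_smul_sum_alexanderMatrix (w : D.Arc → W) (c : X) :
    φ (D.rowUnit c) • ∑ j, φ (D.alexanderMatrix c j) • w j =
      (φ (D.meridian (D.underIn c)) - 1) • w (D.arc (D.overIn c)) + w (D.arc (D.underRight c)) -
        φ (D.meridian (D.overIn c)) • w (D.arc (D.underLeft c)) := by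
  classical
  have hrow (j : D.Arc) := congrArg φ (congrFun (D.rowUnit_smul_row_alexanderMatrix c) j)
  simp only [Pi.smul_apply, smul_eq_mul, map_mul, Matrix.row_apply] at hrow
  simp only [Finset.smul_sum, smul_smul, hrow]
  simp only [Pi.add_apply, Pi.sub_apply, Pi.smul_apply, smul_eq_mul, map_add, map_sub, map_mul,
    map_one, add_smul, sub_smul, Finset.sum_add_distrib, Finset.sum_sub_distrib, mul_smul,
    ← Finset.smul_sum, Pi.single_apply, apply_ite φ, map_zero, ite_smul, one_smul, zero_smul,
    Finset.sum_ite_eq', Finset.mem_univ, if_true]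

theorem isSolution_map_alexanderMatrix_iff (w : D.Arc → W) :
    IsSolution (D.alexanderMatrix.map φ) w ↔ ∀ c,
      w (D.arc (D.underRight c)) +
          (φ (D.meridian (D.underIn c)) - 1) • w (D.arc (D.overIn c)) =
        φ (D.meridian (D.overIn c)) • w (D.arc (D.underLeft c)) := by
  refine forall_congr' fun c => ?_
  have hunit : IsUnit (φ (D.rowUnit c)) := (D.rowUnit c).isUnit.map φ
  rw [← hunit.smul_eq_zero]
  simp only [Matrix.map_apply]
  rw [rowUnit_smul_sum_alexanderMatrix, sub_eq_zero, add_comm]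

theorem isSolution_alexanderMatrix_var_sub_one :
    IsSolution D.alexanderMatrix fun j =>
      (MvLaurent.var (D.arcComponent j) : MvLaurent D.Component) - 1 := by
  classical
  suffices IsSolution (D.alexanderMatrix.map (RingHom.id _)) fun j =>
      (MvLaurent.var (D.arcComponent j) : MvLaurent D.Component) - 1 by
    simpa using this
  rw [isSolution_map_alexanderMatrix_iff]
  intro c
  have hright : D.component (D.underRight c) = D.component (D.underIn c) := by
    unfold underRight
    split_ifs
    · rfl
    · exact D.component_next _
  have hleft : D.component (D.underLeft c) = D.component (D.underIn c) := by
    unfold underLeft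
    split_ifs
    · exact D.component_next _
    · rfl
  simp only [arcComponent_arc, hright, hleft, RingHom.id_apply, meridian, smul_eq_mul]
  ring

end Solutions

section Minors

/-- The rows `f` of the Alexander matrix generate its row space. -/
def RowsSpan {ι : Type*} (f : ι → X) : Prop :=
  ∀ c, D.alexanderMatrix.row c ∈
    Submodule.span (MvLaurent D.Component) (Set.range (D.alexanderMatrix.row ∘ f))

variable {D}

theorem RowsSpan.of_range_eq {ι ι' : Type*} {f : ι → X} {f' : ι' → X} (hf : D.RowsSpan f)
    (h : Set.range f' = Set.range f) : D.RowsSpan f' := fun c => by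
  rw [Set.range_comp, h, ← Set.range_comp]
  exact hf c

theorem RowsSpan.isSolution [Fintype D.Arc] {ι A W : Type*} [CommRing A] [AddCommGroup W]
    [Module A W] {f : ι → X} (hf : D.RowsSpan f) {φ : MvLaurent D.Component →+* A} {w : D.Arc → W}
    (h : IsSolution ((D.alexanderMatrix.submatrix f id).map φ) w) :
    IsSolution (D.alexanderMatrix.map φ) w := by
  intro c
  change ∑ j, φ (D.alexanderMatrix.row c j) • w j = 0
  have hr := hf c
  generalize D.alexanderMatrix.row c = r at hr
  induction hr using Submodule.span_induction with
  | mem r hr =>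
    obtain ⟨i, rfl⟩ := hr
    exact h i
  | zero => simp
  | add r r' _ _ h h' => simp [add_smul, Finset.sum_add_distrib, h, h']
  | smul t r _ h => simp [mul_smul, ← Finset.smul_sum, h]

variable [Fintype S] (D)

theorem alexanderMinor_eq (j : D.Arc) [Fintype {a : D.Arc // a ≠ j}]
    [DecidableEq {a : D.Arc // a ≠ j}] (f : {a : D.Arc // a ≠ j} → X) :
    D.alexanderMinor j f = (D.alexanderMatrix.submatrix f Subtype.val).det := by
  unfold alexanderMinor
  congr!

variable {D} in
theorem RowsSpan.alexanderMinor_dvd {j : D.Arc} {f : {a : D.Arc // a ≠ j} → X} (hf : D.RowsSpan f)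
    (f' : {a : D.Arc // a ≠ j} → X) : D.alexanderMinor j f ∣ D.alexanderMinor j f' := by
  classical
  let : Fintype {a : D.Arc // a ≠ j} := Fintype.ofFinite _
  rw [alexanderMinor_eq, alexanderMinor_eq]
  choose Z hZ using fun a => (Submodule.mem_span_range_iff_exists_fun (MvLaurent D.Component)).1
    (hf (f' a))
  refine ⟨(Matrix.of Z).det, ?_⟩
  rw [mul_comm, ← Matrix.det_mul]
  congr 1
  ext1 a b
  simpa [Matrix.mul_apply, Finset.sum_apply] using (congrFun (hZ a) b.1).symm

open Classical in
theorem exists_alexanderMinor_eq_det_updateCol {j j' : D.Arc} [Fintype {a : D.Arc // a ≠ j}]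
    (hj : j' ≠ j) (f : {a : D.Arc // a ≠ j} → X) :
    ∃ f' : {a : D.Arc // a ≠ j'} → X, Set.range f' = Set.range f ∧ D.alexanderMinor j' f' =
      ((D.alexanderMatrix.submatrix f Subtype.val).updateCol ⟨j', hj⟩
        fun a => D.alexanderMatrix (f a) j).det := by
  let : Fintype {a : D.Arc // a ≠ j'} := Fintype.ofFinite _
  let e : {a : D.Arc // a ≠ j} ≃ {a : D.Arc // a ≠ j'} :=
    (Equiv.swap j j').subtypeEquiv fun a => by simp [Equiv.swap_apply_eq_iff]
  refine ⟨f ∘ e.symm, by rw [Set.range_comp, e.symm.range_eq_univ, Set.image_univ], ?_⟩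
  rw [alexanderMinor_eq, ← Matrix.det_submatrix_equiv_self e]
  congr 1
  ext1 a b
  have he : (e b).1 = Equiv.swap j j' b.1 := rfl
  simp only [Matrix.submatrix_apply, Function.comp_apply, Equiv.symm_apply_apply,
    Matrix.updateCol_apply, he]
  split_ifs with hb
  · rw [hb, Equiv.swap_apply_right]
  · rw [Equiv.swap_apply_of_ne_of_ne b.2 fun h => hb (Subtype.ext h)]

theorem exists_alexanderMinor_associated (j j' : D.Arc) (f : {a : D.Arc // a ≠ j} → X) :
    ∃ f' : {a : D.Arc // a ≠ j'} → X, Set.range f' = Set.range f ∧ Associated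
      (((MvLaurent.var (D.arcComponent j) : MvLaurent D.Component) - 1) * D.alexanderMinor j' f')
      (((MvLaurent.var (D.arcComponent j') : MvLaurent D.Component) - 1) *
        D.alexanderMinor j f) := by
  classical
  let : Fintype D.Arc := Fintype.ofFinite _
  rcases eq_or_ne j' j with rfl | hj
  · exact ⟨f, rfl, Associated.rfl⟩
  obtain ⟨f', hf', hminor⟩ := D.exists_alexanderMinor_eq_det_updateCol hj f
  refine ⟨f', hf', ?_⟩
  rw [hminor, D.alexanderMinor_eq j f, mul_det_updateCol_eq_neg_mul_det
    (v := fun b => (MvLaurent.var (D.arcComponent b.1) : MvLaurent D.Component) - 1)]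
  · exact Associated.neg_left Associated.rfl
  · intro a
    have hsum := D.isSolution_alexanderMatrix_var_sub_one (f a)
    rwa [Fintype.sum_eq_add_sum_subtype_ne _ j] at hsum

theorem isAlexanderPolynomial_of_associated {j j₁ : D.Arc}
    (hj : D.arcComponent j ≠ D.arcComponent j₁) {q : MvLaurent D.Component}
    (hq : ∀ j', ∃ f, D.RowsSpan f ∧ Associated (D.alexanderMinor j' f)
      (((MvLaurent.var (D.arcComponent j') : MvLaurent D.Component) - 1) * q)) :
    D.IsAlexanderPolynomial q := by
  refine fun δ => ⟨fun hδ p hp => hδ.trans ?_, fun hδ => ?_⟩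
  · rw [← Ideal.mem_span_singleton]
    refine Ideal.span_le.2 ?_ hp
    rintro _ ⟨j', g, rfl⟩
    obtain ⟨f, hf, hfq⟩ := hq j'
    rw [SetLike.mem_coe, Ideal.mem_span_singleton]
    exact (dvd_mul_left _ _).trans (hfq.symm.dvd.trans (hf.alexanderMinor_dvd g))
  · have hdvd (j' : D.Arc) :
        δ ∣ ((MvLaurent.var (D.arcComponent j') : MvLaurent D.Component) - 1) * q := by
      obtain ⟨f, -, hfq⟩ := hq j'
      exact (hδ _ (Ideal.subset_span ⟨j', f, rfl⟩)).trans hfq.dvd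
    exact MvLaurent.dvd_of_dvd_var_sub_one_mul hj (hdvd j) (hdvd j₁)

variable {D}

theorem RowsSpan.exists_isAlexanderPolynomial {j j₁ : D.Arc}
    (hj : D.arcComponent j ≠ D.arcComponent j₁) {f : {a : D.Arc // a ≠ j} → X}
    (hf : D.RowsSpan f) :
    ∃ q, D.IsAlexanderPolynomial q ∧ D.alexanderMinor j f =
      ((MvLaurent.var (D.arcComponent j) : MvLaurent D.Component) - 1) * q := by
  obtain ⟨f₁, -, h₁⟩ := D.exists_alexanderMinor_associated j j₁ f
  obtain ⟨q, hq⟩ := MvLaurent.var_sub_one_dvd_of_dvd_mul hj ((dvd_mul_right _ _).trans h₁.dvd)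
  refine ⟨q, D.isAlexanderPolynomial_of_associated hj fun j' => ?_, hq⟩
  obtain ⟨f', hf', h'⟩ := D.exists_alexanderMinor_associated j j' f
  refine ⟨f', hf.of_range_eq hf', ?_⟩
  rw [hq, mul_left_comm] at h'
  exact Associated.of_mul_left h' Associated.rfl (MvLaurent.var_sub_one_ne_zero _)

theorem IsAlexanderPolynomial.associated {p q : MvLaurent D.Component}
    (hp : D.IsAlexanderPolynomial p) (hq : D.IsAlexanderPolynomial q) : Associated p q :=
  associated_of_dvd_dvd ((hq p).2 ((hp p).1 dvd_rfl)) ((hp q).2 ((hq q).1 dvd_rfl))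

end Minors

section Numberings

theorem exists_iterate_next_eq_iff {s : S} (hs : s ∉ Set.range D.underIn) (c : X) :
    (∃ n, D.next^[n] s = D.underIn c ∧ ∀ m < n, D.next^[m] s ∉ Set.range D.underIn) ↔
      ∃ n, D.next^[n] (D.next s) = D.underIn c ∧
        ∀ m < n, D.next^[m] (D.next s) ∉ Set.range D.underIn := by
  constructor
  · rintro ⟨_ | n, hn, hmin⟩
    · exact absurd ⟨c, hn.symm⟩ hs
    · exact ⟨n, hn, fun m hm => hmin (m + 1) (by lia)⟩
  · rintro ⟨n, hn, hmin⟩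
    refine ⟨n + 1, hn, fun m hm => ?_⟩
    rcases m with _ | m
    · exact hs
    · exact hmin m (by lia)

/-- An arc ends at the first undercrossing that is met when running along it. -/
theorem arc_underIn_injective : Function.Injective fun c => D.arc (D.underIn c) := by
  let ends : D.Arc → Set X := Quot.lift (fun s => {c | ∃ n, D.next^[n] s = D.underIn c ∧
    ∀ m < n, D.next^[m] s ∉ Set.range D.underIn}) (by
      rintro s _ ⟨rfl, hs⟩
      exact Set.ext (D.exists_iterate_next_eq_iff hs))
  intro c c' h
  have hc : c ∈ ends (D.arc (D.underIn c)) := ⟨0, rfl, by simp⟩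
  rw [show D.arc (D.underIn c) = D.arc (D.underIn c') from h] at hc
  obtain ⟨_ | n, hn, hmin⟩ := hc
  · exact (D.underIn_injective hn).symm
  · exact absurd ⟨c', rfl⟩ (hmin 0 (by lia))

theorem exists_rows (j : D.Arc) (c₀ : X) :
    ∃ f : {a : D.Arc // a ≠ j} → X, ∀ c ≠ c₀, c ∈ Set.range f := by
  classical
  have : Nonempty X := ⟨c₀⟩
  let g : X → D.Arc := Equiv.swap (D.arc (D.underIn c₀)) j ∘ fun c => D.arc (D.underIn c)
  have hg : Function.Injective g := (Equiv.injective _).comp D.arc_underIn_injective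
  have hg₀ : g c₀ = j := Equiv.swap_apply_left _ _
  exact ⟨fun a => Function.invFun g a, fun c hc =>
    ⟨⟨g c, fun h => hc (hg (h.trans hg₀.symm))⟩, Function.leftInverse_invFun hg c⟩⟩

variable (lab : S → D.Component →₀ ℤ)

/-- The condition that an Alexander numbering has to satisfy at a crossing where the strand entered
by `q` crosses the strand entered by `p` from right to left. The label of a segment stands for the
label of the region on its right, as an exponent of a monomial; the region on its left has the label
of the segment times the variable of its component. -/
def NumbersPair (p q : S) : Prop :=
  lab (D.next p) = lab q ∧ lab p = lab q + Finsupp.single (D.component q) 1 ∧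
    lab (D.next q) = lab q + Finsupp.single (D.component p) 1

open Classical in
/-- The condition that an Alexander numbering has to satisfy at the crossing `c`. -/
def NumbersCrossing (c : X) : Prop :=
  if D.sign c = 1 then D.NumbersPair lab (D.overIn c) (D.underIn c)
  else D.NumbersPair lab (D.underIn c) (D.overIn c)

/-- An Alexander numbering of the diagram. -/
structure IsNumbering : Prop where
  next_eq : ∀ s, s ∉ Set.range (Sum.elim D.overIn D.underIn) → lab (D.next s) = lab s
  numbersCrossing : ∀ c, D.NumbersCrossing lab c

theorem sum_sub_next_eq_zero [Finite S] [Fintype X] {W : Type*} [AddCommGroup W] (β : S → W)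
    (hβ : ∀ s, s ∉ Set.range (Sum.elim D.overIn D.underIn) → β (D.next s) = β s) :
    ∑ c, (β (D.overIn c) - β (D.next (D.overIn c)) +
      (β (D.underIn c) - β (D.next (D.underIn c)))) = 0 := by
  classical
  let : Fintype S := Fintype.ofFinite S
  have htotal : ∑ s, (β s - β (D.next s)) = 0 := by
    rw [Finset.sum_sub_distrib, sub_eq_zero]
    exact (Equiv.sum_comp (Equiv.ofBijective _
      (Finite.injective_iff_bijective.1 D.next_injective)) β).symm
  rw [Finset.sum_add_distrib, ← htotal]
  refine (Fintype.sum_sum_type fun x => β (Sum.elim D.overIn D.underIn x) -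
    β (D.next (Sum.elim D.overIn D.underIn x))).symm.trans ?_
  rw [← Finset.sum_image (s := Finset.univ) (g := Sum.elim D.overIn D.underIn)
    (f := fun s => β s - β (D.next s)) fun _ _ _ _ h => D.pass_injective h]
  refine Finset.sum_subset (Finset.subset_univ _) fun s _ hs => ?_
  rw [hβ s (by simpa using hs), sub_self]

variable {D lab}

/-- Every row of the Alexander matrix, suitably normalized, is the sum of the differences of
`β s = monomial (lab s) • arc s` between the incoming and the outgoing segments at the crossing. -/
theorem IsNumbering.exists_sum_smul_row_eq_zero [Finite S] [Fintype X]
    (h : D.IsNumbering lab) :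
    ∃ u : X → (MvLaurent D.Component)ˣ, ∑ c, u c • D.alexanderMatrix.row c = 0 := by
  classical
  let β (s : S) : D.Arc → MvLaurent D.Component :=
    (MvLaurent.monomial (lab s) : MvLaurent D.Component) • Pi.single (D.arc s) 1
  refine ⟨fun c => (if D.sign c = 1 then 1 else -1) * MvLaurent.monomial (lab (D.underRight c)) *
    D.rowUnit c, ?_⟩
  rw [← D.sum_sub_next_eq_zero β]
  · refine Finset.sum_congr rfl fun c _ => ?_
    have hover := D.arc_next (D.overIn_notMem_range_underIn c)
    rw [mul_smul, Units.smul_def (D.rowUnit c), rowUnit_smul_row_alexanderMatrix]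
    have hc' := h.numbersCrossing c
    by_cases hc : D.sign c = 1
    · rw [NumbersCrossing, if_pos hc] at hc'
      obtain ⟨h1, h2, h3⟩ := hc'
      simp only [β, underRight, underLeft, hc, if_true, hover, h1, h2, h3, MvLaurent.monomial_add,
        MvLaurent.monomial_single, Units.smul_def, Units.val_mul, one_mul]
      rw [meridian, meridian]
      module
    · rw [NumbersCrossing, if_neg hc] at hc'
      obtain ⟨h1, h2, h3⟩ := hc'
      simp only [β, underRight, underLeft, hc, if_false, hover, h1, h2, h3, MvLaurent.monomial_add,
        MvLaurent.monomial_single, Units.smul_def, Units.val_mul, Units.val_neg, Units.val_one]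
      rw [meridian, meridian]
      module
  · intro s hs
    have hunder : s ∉ Set.range D.underIn := fun ⟨c, hc⟩ => hs ⟨Sum.inr c, hc⟩
    simp only [β, h.next_eq s hs, D.arc_next hunder]

theorem IsNumbering.rowsSpan [Finite S] [Finite X] (h : D.IsNumbering lab) {ι : Type*}
    {f : ι → X} {c₀ : X} (hf : ∀ c ≠ c₀, c ∈ Set.range f) : D.RowsSpan f := by
  classical
  let : Fintype X := Fintype.ofFinite X
  have hmem (c : X) (hc : c ≠ c₀) : D.alexanderMatrix.row c ∈
      Submodule.span (MvLaurent D.Component) (Set.range (D.alexanderMatrix.row ∘ f)) := by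
    obtain ⟨a, rfl⟩ := hf c hc
    exact Submodule.subset_span ⟨a, rfl⟩
  intro c
  rcases eq_or_ne c c₀ with rfl | hc
  · obtain ⟨u, hu⟩ := h.exists_sum_smul_row_eq_zero
    rw [← Finset.add_sum_erase _ _ (Finset.mem_univ c), add_eq_zero_iff_eq_neg] at hu
    rw [← inv_smul_smul (u c) (D.alexanderMatrix.row c), hu]
    exact Submodule.smul_mem _ _ (Submodule.neg_mem _ (Submodule.sum_mem _ fun c' hc' =>
      Submodule.smul_mem _ _ (hmem c' (Finset.ne_of_mem_erase hc'))))
  · exact hmem c hc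

end Numberings

end LinkDiagram

/-! ### The homology of the cellulated sphere -/

namespace Dart

/-- The reversal of directed edges as a permutation. -/
def revEquiv {E : Type*} : Equiv.Perm (E × Bool) where
  toFun := rev
  invFun := rev
  left_inv := rev_rev
  right_inv := rev_rev

theorem revEquiv_apply {E : Type*} (d : E × Bool) : revEquiv d = rev d := rfl

end Dart

namespace PeriodicGraph

variable {V E : Type*} (G : PeriodicGraph V E)

theorem exists_start_eq (v : V) : ∃ d, G.start d = v := by
  obtain ⟨e, h | h⟩ := G.not_isolated v
  · exact ⟨(e, true), h⟩
  · exact ⟨(e, false), h⟩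

theorem apply_eq_of_component_eq {Z : Type*} {w : V → Z} (hw : ∀ e, w (G.src e) = w (G.tgt e))
    {u v : V} (h : G.quotientGraph.connectedComponentMk u =
      G.quotientGraph.connectedComponentMk v) : w u = w v := by
  obtain ⟨p⟩ := SimpleGraph.ConnectedComponent.exact h
  induction p with
  | nil => rfl
  | cons hadj _ ih =>
    rw [← ih (SimpleGraph.ConnectedComponent.sound ⟨by assumption⟩)]
    rw [quotientGraph, SimpleGraph.fromRel_adj] at hadj
    obtain ⟨-, ⟨e, rfl, rfl⟩ | ⟨e, rfl, rfl⟩⟩ := hadj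
    · exact hw e
    · exact (hw e).symm

end PeriodicGraph

namespace AnnularEmbedding

variable {V E R : Type*} [Fintype V] [Fintype E] [Fintype R] {G : PeriodicGraph V E}
  (P : AnnularEmbedding G R)

theorem induction_of_connected {p : V ⊕ R → Prop} {x₀ : V ⊕ R} (h₀ : p x₀)
    (h : ∀ d, p (Sum.inl (G.start d)) ↔ p (Sum.inr (P.left d))) (x : V ⊕ R) : p x := by
  obtain ⟨q⟩ := P.connected.preconnected x₀ x
  induction q with
  | nil => exact h₀
  | cons hadj _ ih =>
    apply ih
    rw [SimpleGraph.fromRel_adj] at hadj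
    obtain ⟨-, ⟨d, rfl, rfl⟩ | ⟨d, rfl, rfl⟩⟩ := hadj
    · exact (h d).1 h₀
    · exact (h d).2 h₀

theorem left_rot_symm (d : E × Bool) : P.left (P.rot.symm d) = P.left (Dart.rev d) := by
  simpa using P.left_corner (P.rot.symm d)

theorem start_rot_symm (d : E × Bool) : G.start (P.rot.symm d) = G.start d := by
  simpa using (P.start_rot (P.rot.symm d)).symm

theorem apply_eq_of_rot {Z : Type*} {y : E × Bool → Z} (hy : ∀ d, y (P.rot d) = y d)
    {d d' : E × Bool} (h : G.start d = G.start d') : y d = y d' := by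
  obtain ⟨n, rfl⟩ := (P.sameCycle_rot d d' h).exists_nat_pow_eq
  clear h
  induction n with
  | zero => rfl
  | succ n ih => rw [pow_succ', Equiv.Perm.mul_apply, hy, ih]

section Chains

variable (k : Type*) [CommRing k]

open Classical in
/-- The boundary map of the incidence graph of vertices and regions, whose edges are the corners:
the corner `d` joins the vertex `start d` to the region `left d`. -/
def boundary : (E × Bool → k) →ₗ[k] (V → k) × (R → k) where
  toFun z := (fun v => ∑ d, if G.start d = v then z d else 0,
    fun r => ∑ d, if P.left d = r then z d else 0)
  map_add' z z' := by
    ext <;> simp [← Finset.sum_add_distrib, ← ite_add_zero]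
  map_smul' a z := by
    ext <;> simp [Finset.mul_sum]

/-- The boundary map of the quadrilaterals that are spanned by an edge and the two regions next to
it. Gluing these quadrilaterals to the incidence graph of vertices and regions gives the sphere. -/
def quadBoundary : (E → k) →ₗ[k] (E × Bool → k) where
  toFun y d := y d.1 - y (P.rot d).1
  map_add' y y' := by ext; simp; ring
  map_smul' a y := by ext; simp; ring

theorem boundary_quadBoundary (y : E → k) : P.boundary k (P.quadBoundary k y) = 0 := by
  classical
  have hstart : ∀ v, ∑ d, (if G.start d = v then y d.1 else 0) =
      ∑ d, if G.start d = v then y (P.rot d).1 else 0 := fun v => by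
    rw [← Equiv.sum_comp P.rot]
    simp only [P.start_rot]
  have hleft : ∀ r, ∑ d, (if P.left d = r then y d.1 else 0) =
      ∑ d, if P.left d = r then y (P.rot d).1 else 0 := fun r => by
    rw [← Equiv.sum_comp (P.rot.trans Dart.revEquiv)]
    simp only [Equiv.trans_apply, Dart.revEquiv_apply, ← P.left_corner]
    rfl
  have hsub : ∀ (p : Prop) [Decidable p] (a b : k),
      (if p then a - b else 0) = (if p then a else 0) - if p then b else 0 := by
    intros; split_ifs <;> simp
  ext i <;> simp only [boundary, quadBoundary, LinearMap.coe_mk, AddHom.coe_mk, hsub,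
    Finset.sum_sub_distrib]
  · exact sub_eq_zero.2 (hstart i)
  · exact sub_eq_zero.2 (hleft i)

open Classical in
theorem boundary_single (d : E × Bool) (a : k) : P.boundary k (Pi.single d a) =
    (Pi.single (G.start d) a, Pi.single (P.left d) a) := by
  have hcomm : ∀ (p q : Prop) [Decidable p] [Decidable q] (a : k),
      (if p then (if q then a else 0) else 0) = if q then (if p then a else 0) else 0 := by
    intros; split_ifs <;> simp
  ext i <;>
    simp only [boundary, LinearMap.coe_mk, AddHom.coe_mk, Pi.single_apply, hcomm,
      Finset.sum_ite_eq, Finset.mem_univ, if_true, eq_comm]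

end Chains

theorem finrank_ker_quadBoundary_le (k : Type*) [Field k] :
    Module.finrank k (LinearMap.ker (P.quadBoundary k)) ≤
      Nat.card G.quotientGraph.ConnectedComponent := by
  classical
  let : Fintype G.quotientGraph.ConnectedComponent := Fintype.ofFinite _
  let ψ : (G.quotientGraph.ConnectedComponent → k) →ₗ[k] (E → k) :=
    LinearMap.funLeft k k fun e => G.quotientGraph.connectedComponentMk (G.src e)
  have hle : LinearMap.ker (P.quadBoundary k) ≤ LinearMap.range ψ := by
    intro y hy
    have hrot : ∀ d, y (P.rot d).1 = y d.1 := fun d =>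
      (sub_eq_zero.1 (congrFun (LinearMap.mem_ker.1 hy) d)).symm
    have hstart : ∀ d d', G.start d = G.start d' → y d.1 = y d'.1 := fun d d' h =>
      P.apply_eq_of_rot (y := fun d => y d.1) hrot h
    choose δ hδ using G.exists_start_eq
    have hw : ∀ e, y (δ (G.src e)).1 = y (δ (G.tgt e)).1 := fun e =>
      (hstart _ (e, true) (hδ _)).trans (hstart _ (e, false) (hδ _)).symm
    refine ⟨fun C => y (δ C.out).1, ?_⟩
    ext e
    have := G.apply_eq_of_component_eq (w := fun v => y (δ v).1) hw
      (u := (G.quotientGraph.connectedComponentMk (G.src e)).out) (v := G.src e)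
      (Quot.out_eq _)
    exact this.trans (hstart _ (e, true) (hδ _))
  calc _ ≤ _ := Submodule.finrank_mono hle
    _ ≤ _ := ψ.finrank_range_le
    _ = _ := by rw [Module.finrank_fintype_fun_eq_card, Nat.card_eq_fintype_card]

theorem card_le_finrank_range_boundary (k : Type*) [Field k] :
    Fintype.card V + Fintype.card R ≤
      Module.finrank k (LinearMap.range (P.boundary k)) + 1 := by
  classical
  let x₀ : (V → k) × (R → k) := (0, Pi.single (P.path 0) 1)
  let S := LinearMap.range (P.boundary k) ⊔ Submodule.span k {x₀}
  have hd : ∀ d, ((Pi.single (G.start d) 1, 0) : (V → k) × (R → k)) +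
      (0, Pi.single (P.left d) 1) ∈ S := fun d => by
    refine Submodule.mem_sup_left ⟨Pi.single d 1, ?_⟩
    rw [boundary_single]
    simp
  have hall := P.induction_of_connected (x₀ := Sum.inr (P.path 0))
    (p := Sum.elim (fun v => ((Pi.single v 1, 0) : (V → k) × (R → k)) ∈ S)
      fun r => ((0, Pi.single r 1) : (V → k) × (R → k)) ∈ S)
    (Submodule.mem_sup_right (Submodule.subset_span rfl))
    fun d => ⟨fun h => (Submodule.add_mem_iff_right _ h).1 (hd d),
      fun h => (Submodule.add_mem_iff_left _ h).1 (hd d)⟩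
  have htop : S = ⊤ := by
    rw [eq_top_iff]
    rintro ⟨f, g⟩ -
    have : ((f, g) : (V → k) × (R → k)) =
        ∑ v, f v • ((Pi.single v 1, 0) : (V → k) × (R → k)) +
        ∑ r, g r • ((0, Pi.single r 1) : (V → k) × (R → k)) := by
      ext i <;> simp [Prod.fst_sum, Prod.snd_sum, Finset.sum_apply, Pi.single_apply]
    rw [this]
    exact Submodule.add_mem _
      (Submodule.sum_mem _ fun v _ => Submodule.smul_mem _ _ (hall (Sum.inl v)))
      (Submodule.sum_mem _ fun r _ => Submodule.smul_mem _ _ (hall (Sum.inr r)))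
  have h1 := Submodule.finrank_add_le_finrank_add_finrank (LinearMap.range (P.boundary k))
    (Submodule.span k {x₀})
  have h2 : Module.finrank k (Submodule.span k {x₀}) ≤ 1 := by
    simpa using finrank_span_le_card (R := k) {x₀}
  have h3 : Module.finrank k S = Fintype.card V + Fintype.card R := by
    rw [htop, finrank_top, Module.finrank_prod, Module.finrank_fintype_fun_eq_card,
      Module.finrank_fintype_fun_eq_card]
  change Module.finrank k S ≤ _ at h1
  omega

theorem ker_boundary_field (k : Type*) [Field k] :
    LinearMap.ker (P.boundary k) = LinearMap.range (P.quadBoundary k) := by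
  symm
  apply Submodule.eq_of_le_of_finrank_le
  · rintro _ ⟨y, rfl⟩
    exact P.boundary_quadBoundary k y
  · have h1 := P.finrank_ker_quadBoundary_le k
    have h2 := P.card_le_finrank_range_boundary k
    have h3 := (P.boundary k).finrank_range_add_finrank_ker
    have h4 := (P.quadBoundary k).finrank_range_add_finrank_ker
    have h5 := P.euler
    simp only [Module.finrank_fintype_fun_eq_card, Fintype.card_prod, Fintype.card_bool] at h3 h4
    omega

theorem boundary_map {k k' : Type*} [CommRing k] [CommRing k'] (f : k →+* k') (z : E × Bool → k) :
    P.boundary k' (f ∘ z) = (f ∘ (P.boundary k z).1, f ∘ (P.boundary k z).2) := by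
  ext i <;> simp [boundary, apply_ite f]

theorem ker_boundary_le : LinearMap.ker (P.boundary ℤ) ≤ LinearMap.range (P.quadBoundary ℤ) := by
  apply le_of_fg_of_forall_prime (IsNoetherian.noetherian _)
  intro p hp z hz
  have : Fact p.Prime := ⟨hp⟩
  have hz' : (Int.castRingHom (ZMod p)) ∘ z ∈ LinearMap.ker (P.boundary (ZMod p)) := by
    rw [LinearMap.mem_ker, boundary_map, LinearMap.mem_ker.1 hz]
    ext <;> simp
  rw [ker_boundary_field] at hz'
  obtain ⟨y, hy⟩ := hz'
  choose y' hy' using fun e => ZMod.intCast_surjective (y e)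
  have hdvd : ∀ d, (p : ℤ) ∣ z d - P.quadBoundary ℤ y' d := fun d => by
    rw [← ZMod.intCast_zmod_eq_zero_iff_dvd]
    have := congrFun hy d
    simp only [quadBoundary, LinearMap.coe_mk, AddHom.coe_mk, Function.comp_apply,
      Int.coe_castRingHom] at this ⊢
    push_cast
    rw [hy', hy', this, sub_self]
  choose z' hz' using hdvd
  have hzz : z = P.quadBoundary ℤ y' + (p : ℤ) • z' := by
    ext d
    simp [← hz' d]
  refine ⟨_, ⟨y', rfl⟩, z', ?_, hzz⟩
  have hp0 : (p : ℤ) ≠ 0 := by exact_mod_cast hp.ne_zero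
  rw [hzz, LinearMap.mem_ker, map_add, boundary_quadBoundary, zero_add, map_smul] at hz
  exact (smul_eq_zero.1 hz).resolve_left hp0

section Potential

variable {W : Type*} [AddCommGroup W]

/-- The pairing of integral chains of corners with a function `c` on the corners. -/
def cornerPairing (c : E × Bool → W) : (E × Bool → ℤ) →ₗ[ℤ] W where
  toFun z := ∑ d, z d • c d
  map_add' z z' := by simp [add_smul, Finset.sum_add_distrib]
  map_smul' a z := by simp [mul_smul, Finset.smul_sum]

open Classical in
theorem cornerPairing_single (c : E × Bool → W) (d : E × Bool) :
    cornerPairing c (Pi.single d 1) = c d := by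
  simp [cornerPairing, Pi.single_apply, ite_smul]

theorem cornerPairing_quadBoundary {c : E × Bool → W}
    (hc : ∀ e, c (e, true) + c (e, false) =
      c (P.rot.symm (e, true)) + c (P.rot.symm (e, false))) (y : E → ℤ) :
    cornerPairing c (P.quadBoundary ℤ y) = 0 := by
  have hrot : ∑ d, y (P.rot d).1 • c d = ∑ d, y d.1 • c (P.rot.symm d) := by
    rw [← Equiv.sum_comp P.rot fun d : E × Bool => y d.1 • c (P.rot.symm d)]
    simp
  have hbalanced : ∀ e, ∑ b, (y e • c (e, b) - y e • c (P.rot.symm (e, b))) = 0 := fun e => by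
    simp only [Fintype.sum_bool, ← smul_sub]
    rw [← smul_add, sub_add_sub_comm, hc, sub_self, smul_zero]
  calc cornerPairing c (P.quadBoundary ℤ y)
    _ = ∑ d, (y d.1 - y (P.rot d).1) • c d := rfl
    _ = ∑ d, (y d.1 • c d - y d.1 • c (P.rot.symm d)) := by
      simp only [sub_smul, Finset.sum_sub_distrib, hrot]
    _ = 0 := by rw [Fintype.sum_prod_type, Finset.sum_eq_zero fun e _ => hbalanced e]

open Classical in
theorem exists_boundary_eq (x : V ⊕ R) : ∃ z, P.boundary ℤ z =
    x.elim (fun v => (Pi.single v 1, Pi.single (P.path 0) 1))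
      fun r => (0, Pi.single r 1 - Pi.single (P.path 0) 1) := by
  refine P.induction_of_connected (x₀ := Sum.inr (P.path 0))
    (p := fun x => ∃ z, P.boundary ℤ z = x.elim (fun v => (Pi.single v 1, Pi.single (P.path 0) 1))
      fun r => (0, Pi.single r 1 - Pi.single (P.path 0) 1))
    ⟨0, by simp only [map_zero, Sum.elim_inr, sub_self, Prod.mk_zero_zero]⟩ (fun d => ?_) x
  have hd := P.boundary_single ℤ d 1
  constructor <;>
  · rintro ⟨z, hz⟩
    exact ⟨Pi.single d 1 - z, by rw [map_sub, hd, hz]; ext <;> simp⟩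

/-- This is the vanishing of the first cohomology of the sphere: `c` is a cocycle on the square
complex whose edges are the corners and whose faces are the quadrilaterals around the edges. -/
theorem exists_potential {c : E × Bool → W}
    (hc : ∀ e, c (e, true) + c (e, false) =
      c (P.rot.symm (e, true)) + c (P.rot.symm (e, false))) :
    ∃ (w : V → W) (u : R → W), ∀ d, c d = w (G.start d) + u (P.left d) := by
  classical
  have hker : ∀ z, P.boundary ℤ z = 0 → cornerPairing c z = 0 := fun z hz => by
    obtain ⟨y, rfl⟩ := P.ker_boundary_le hz
    exact P.cornerPairing_quadBoundary hc y
  choose z hz using P.exists_boundary_eq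
  refine ⟨fun v => cornerPairing c (z (.inl v)), fun r => cornerPairing c (z (.inr r)),
    fun d => ?_⟩
  rw [← cornerPairing_single c d, ← map_add, ← sub_eq_zero, ← map_sub]
  apply hker
  rw [map_sub, map_add, boundary_single, hz, hz]
  ext <;> simp

end Potential

end AnnularEmbedding

/-! ### Alexander numberings of the encircled link -/

namespace AnnularEmbedding

variable {V E R : Type*} [Fintype V] [Fintype E] [Fintype R] {G : PeriodicGraph V E}
  {P : AnnularEmbedding G R} (o : P.Orientation)

theorem encircledLink_next : (encircledLink o).next = nextSegment o := rfl
theorem encircledLink_overIn : (encircledLink o).overIn = overSegment o := rfl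
theorem encircledLink_underIn : (encircledLink o).underIn = underSegment o := rfl
theorem encircledLink_sign : (encircledLink o).sign = crossingSign o := rfl

variable {o}

theorem next_strand_of_dir {d : E × Bool} (h : o.dir d = true) :
    nextSegment o (.strand d 0) = .strand d 1 ∧ nextSegment o (.strand d 1) = .strand d 2 ∧
    nextSegment o (.strand d 2) = .strand d 3 ∧ nextSegment o (.strand d 3) = .strand d 4 ∧
    nextSegment o (.strand d 4) = .strand (P.rot.symm (Dart.rev (P.rot d))) 4 := by
  simp [nextSegment, h]

theorem next_strand_of_not_dir {d : E × Bool} (h : o.dir d = false) :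
    nextSegment o (.strand d 4) = .strand d 3 ∧ nextSegment o (.strand d 3) = .strand d 2 ∧
    nextSegment o (.strand d 2) = .strand d 1 ∧ nextSegment o (.strand d 1) = .strand d 0 ∧
    nextSegment o (.strand d 0) = .strand (Dart.rev d) 0 := by
  simp [nextSegment, h]

variable (o)

theorem dir_rot_symm_rev_rot (d : E × Bool) :
    o.dir (P.rot.symm (Dart.rev (P.rot d))) = !o.dir d := by
  simpa using o.dir_second (P.rot d)

/-- The component of the strand of a corner. -/
def strandComponent (d : E × Bool) : (encircledLink o).Component :=
  (encircledLink o).component (.strand d 0)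

theorem component_nextSegment (s : P.Segment) :
    (encircledLink o).component (nextSegment o s) = (encircledLink o).component s :=
  (encircledLink o).component_next s

theorem component_strand (d : E × Bool) (j : Fin 5) :
    (encircledLink o).component (.strand d j) = strandComponent o d := by
  have key : (encircledLink o).component (.strand d 1) = (encircledLink o).component (.strand d 0) ∧
      (encircledLink o).component (.strand d 2) = (encircledLink o).component (.strand d 1) ∧
      (encircledLink o).component (.strand d 3) = (encircledLink o).component (.strand d 2) ∧
      (encircledLink o).component (.strand d 4) = (encircledLink o).component (.strand d 3) := by
    cases h : o.dir d
    · obtain ⟨h4, h3, h2, h1, -⟩ := next_strand_of_not_dir h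
      rw [← h1, ← h2, ← h3, ← h4]
      simp only [component_nextSegment, and_self]
    · obtain ⟨h1, h2, h3, h4, -⟩ := next_strand_of_dir h
      rw [← h4, ← h3, ← h2, ← h1]
      simp only [component_nextSegment, and_self]
  obtain ⟨h1, h2, h3, h4⟩ := key
  fin_cases j
  · rfl
  · exact h1
  · exact h2.trans h1
  · exact h3.trans (h2.trans h1)
  · exact h4.trans (h3.trans (h2.trans h1))

theorem strandComponent_rev (d : E × Bool) :
    strandComponent o (Dart.rev d) = strandComponent o d := by
  have key : ∀ d, o.dir d = false → strandComponent o (Dart.rev d) = strandComponent o d :=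
    fun d h => by
      rw [strandComponent, ← (next_strand_of_not_dir h).2.2.2.2, component_nextSegment]
      rfl
  cases h : o.dir d
  · exact key d h
  · have := key (Dart.rev d) (by rw [o.dir_first, h]; rfl)
    rw [Dart.rev_rev] at this
    exact this.symm

theorem strandComponent_rot_symm_rev (d : E × Bool) :
    strandComponent o (P.rot.symm (Dart.rev d)) = strandComponent o (P.rot.symm d) := by
  have key : ∀ d, o.dir (P.rot.symm d) = true →
      strandComponent o (P.rot.symm (Dart.rev d)) = strandComponent o (P.rot.symm d) :=
    fun d h => by
      have := (next_strand_of_dir h).2.2.2.2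
      rw [Equiv.apply_symm_apply] at this
      rw [← component_strand o _ 4, ← this, component_nextSegment, component_strand]
  cases h : o.dir (P.rot.symm d)
  · have := key (Dart.rev d) (by rw [o.dir_second, h]; rfl)
    rw [Dart.rev_rev] at this
    exact this.symm
  · exact key d h

theorem component_front (j : Fin (2 * P.k + 1)) :
    (encircledLink o).component (.front j) = circle o := by
  obtain ⟨j, hj⟩ := j
  induction j with
  | zero => rfl
  | succ j ih =>
    rw [← ih (by omega), ← component_nextSegment o (.front ⟨j, _⟩)]
    simp [nextSegment, show j < 2 * P.k by omega]

theorem component_back (j : Fin (2 * P.k + 1)) :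
    (encircledLink o).component (.back j) = circle o := by
  obtain ⟨j, hj⟩ := j
  induction j with
  | zero =>
    rw [← component_front o ⟨0, hj⟩, ← component_nextSegment o (.back _)]
    simp [nextSegment]
  | succ j ih =>
    rw [← ih (by omega), ← component_nextSegment o (.back ⟨j + 1, _⟩)]
    simp [nextSegment]

theorem strandComponent_ne_circle (d : E × Bool) : strandComponent o d ≠ circle o := by
  intro h
  let isStrand : P.Segment → Prop
    | .strand _ _ => True
    | .front _ => False
    | .back _ => False
  have hnext : ∀ s s' : P.Segment, (encircledLink o).next s = s' → isStrand s = isStrand s' := by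
    rintro (⟨d, j⟩ | j | j) _ rfl <;> simp only [encircledLink_next, nextSegment] <;>
      split_ifs <;> rfl
  have := congrArg (Quot.lift isStrand hnext) h
  exact this.mp trivial

variable {o}

theorem firstIn_of_not_dir {d : E × Bool} (h : o.dir d = false) :
    firstIn o d.1 = .strand d 0 := by
  have h2 := o.dir_first d
  rcases d with ⟨e, _ | _⟩ <;> simp_all [firstIn, Dart.rev]

theorem secondIn_of_dir {d : E × Bool} (h : o.dir d = true) :
    secondIn o (P.rot d).1 = .strand d 4 := by
  have h2 := dir_rot_symm_rev_rot o d
  have h3 : P.rot.symm (P.rot d) = d := P.rot.symm_apply_apply d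
  generalize P.rot d = d' at *
  rcases d' with ⟨e, _ | _⟩ <;> simp_all [secondIn, Dart.rev]

variable (o)

theorem exists_strands (e : E) : ∃ d₁ d₂, d₁.1 = e ∧ o.dir d₁ = false ∧ o.dir d₂ = true ∧
    firstIn o e = .strand d₁ 0 ∧ secondIn o e = .strand d₂ 4 ∧
    ((P.rot d₂ = d₁ ∧ crossingSign o (.edge e) = G.sign e) ∨
      (P.rot d₂ = Dart.rev d₁ ∧ crossingSign o (.edge e) = -G.sign e)) := by
  have h1 := o.dir_first (e, true)
  have h2 := o.dir_second (e, true)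
  have hr : Dart.rev (e, true) = (e, false) := rfl
  have hr' : Dart.rev (e, false) = (e, true) := rfl
  rw [hr] at h1 h2
  cases h : o.dir (e, true) <;> cases h' : o.dir (P.rot.symm (e, true)) <;>
    rw [h] at h1 <;> rw [h'] at h2
  · exact ⟨(e, true), P.rot.symm (e, false), rfl, h, h2, by simp [firstIn, h],
      by simp [secondIn, h'], Or.inr ⟨by simp [hr], by simp [crossingSign, h, h']⟩⟩
  · exact ⟨(e, true), P.rot.symm (e, true), rfl, h, h', by simp [firstIn, h],
      by simp [secondIn, h'], Or.inl ⟨by simp, by simp [crossingSign, h, h']⟩⟩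
  · exact ⟨(e, false), P.rot.symm (e, false), rfl, h1, h2, by simp [firstIn, h],
      by simp [secondIn, h'], Or.inl ⟨by simp, by simp [crossingSign, h, h']⟩⟩
  · exact ⟨(e, false), P.rot.symm (e, true), rfl, h1, h', by simp [firstIn, h],
      by simp [secondIn, h'], Or.inr ⟨by simp [hr'], by simp [crossingSign, h, h']⟩⟩

/-- Values at the pieces into which `γ` is cut by the strands: regions and vertices in turn. -/
def alongPath {Z : Type*} (r : R → Z) (v : V → Z) (j : Fin (2 * P.k + 1)) : Z :=
  if h : (j : ℕ) % 2 = 0 then r (P.path ⟨j / 2, by omega⟩)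
  else v (G.start (P.cut ⟨j / 2, by omega⟩))

theorem alongPath_two_mul {Z : Type*} (r : R → Z) (v : V → Z) (i : Fin (P.k + 1)) :
    alongPath (P := P) r v ⟨2 * i, by lia⟩ = r (P.path i) := by
  simp [alongPath]

theorem alongPath_start_cut {Z : Type*} (r : R → Z) (v : V → Z) (i : Fin P.k) :
    alongPath (P := P) r v ⟨2 * i + 1, by lia⟩ = v (G.start (P.cut i)) := by
  simp [alongPath, show (2 * (i : ℕ) + 1) / 2 = i by lia]

theorem alongPath_left_cut {Z : Type*} (r : R → Z) (v : V → Z) (i : Fin P.k) :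
    alongPath (P := P) r v ⟨2 * i, by lia⟩ = r (P.left (P.cut i)) := by
  rw [P.left_cut]
  exact alongPath_two_mul r v i.castSucc

theorem alongPath_left_rot_symm_cut {Z : Type*} (r : R → Z) (v : V → Z) (i : Fin P.k) :
    alongPath (P := P) r v ⟨2 * i + 1 + 1, by lia⟩ = r (P.left (P.rot.symm (P.cut i))) := by
  rw [P.left_rot_symm, P.right_cut]
  exact alongPath_two_mul r v i.succ

theorem nextSegment_front {j : ℕ} (hj : j < 2 * P.k) :
    nextSegment o (.front ⟨j, by omega⟩) = .front ⟨j + 1, by omega⟩ := by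
  simp [nextSegment, hj]

theorem nextSegment_back {j : ℕ} (hj : j + 1 < 2 * P.k + 1) :
    nextSegment o (.back ⟨j + 1, hj⟩) = .back ⟨j, by omega⟩ := by
  simp [nextSegment]

theorem edge_mem_range (e : E) :
    firstIn o e ∈ Set.range (Sum.elim (overSegment o) (underSegment o)) ∧
    secondIn o e ∈ Set.range (Sum.elim (overSegment o) (underSegment o)) := by
  by_cases h : G.sign e = 1
  · exact ⟨⟨Sum.inl (.edge e), by simp [overSegment, h]⟩,
      ⟨Sum.inr (.edge e), by simp [underSegment, h]⟩⟩
  · exact ⟨⟨Sum.inr (.edge e), by simp [underSegment, h]⟩,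
      ⟨Sum.inl (.edge e), by simp [overSegment, h]⟩⟩

section Numbering

/-- Alexander numberings `PV` of the vertices and `PR` of the regions, which are the faces of the
diagram of the medial link: the strand of the corner `d` separates the face of the vertex `start d`
from the face of the region `left d`. -/
structure NumbersFaces (PV : V → (encircledLink o).Component →₀ ℤ)
    (PR : R → (encircledLink o).Component →₀ ℤ) : Prop where
  of_dir : ∀ {d}, o.dir d = true →
    PV (G.start d) = PR (P.left d) + Finsupp.single (strandComponent o d) 1
  of_not_dir : ∀ {d}, o.dir d = false →
    PR (P.left d) = PV (G.start d) + Finsupp.single (strandComponent o d) 1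

theorem exists_numbersFaces : ∃ PV PR, NumbersFaces o PV PR := by
  obtain ⟨w, u, hwu⟩ := P.exists_potential (c := fun d => (if o.dir d then 1 else -1 : ℤ) •
      (Finsupp.single (strandComponent o d) 1 : (encircledLink o).Component →₀ ℤ)) fun e => by
    have h₁ := o.dir_first (e, true)
    have h₂ := o.dir_second (e, true)
    have h₃ := strandComponent_rev o (e, true)
    have h₄ := strandComponent_rot_symm_rev o (e, true)
    simp only [Dart.rev, Bool.not_true] at h₁ h₂ h₃ h₄
    rw [h₁, h₂, h₃, h₄]
    cases o.dir (e, true) <;> cases o.dir (P.rot.symm (e, true)) <;> simp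
  refine ⟨w, -u, fun {d} h => ?_, fun {d} h => ?_⟩ <;> have hd := hwu d
  · rw [if_pos h, one_smul] at hd
    rw [hd, Pi.neg_apply]
    abel
  · rw [h, if_neg Bool.false_ne_true, neg_smul, one_smul, neg_eq_iff_eq_neg] at hd
    rw [hd, Pi.neg_apply]
    abel

variable (PV : V → (encircledLink o).Component →₀ ℤ) (PR : R → (encircledLink o).Component →₀ ℤ)

open Classical in
/-- The labels of the segments of the encircled link that extend the labels `PV` and `PR` of the
faces of the medial link. The segments of the strands between the two parallels of `C` lie inside
of the circle `C`, which raises their labels by the variable of `C`. -/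
def numbering : P.Segment → (encircledLink o).Component →₀ ℤ
  | .strand d j => (if o.dir d then PR (P.left d) else PV (G.start d)) +
      if (j = 1 ∧ d ∈ Set.range P.cut) ∨ (j = 3 ∧ P.rot d ∈ Set.range P.cut) then
        Finsupp.single (circle o) 1 else 0
  | .front j => alongPath PR PV j
  | .back j => alongPath PR PV j

theorem numbering_nextSegment {s : P.Segment}
    (hs : s ∉ Set.range (Sum.elim (overSegment o) (underSegment o))) :
    numbering o PV PR (nextSegment o s) = numbering o PV PR s := by
  have hover : ∀ c, overSegment o c ≠ s := fun c h => hs ⟨Sum.inl c, h⟩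
  have hunder : ∀ c, underSegment o c ≠ s := fun c h => hs ⟨Sum.inr c, h⟩
  rcases s with ⟨d, j⟩ | ⟨j, hj⟩ | ⟨j, hj⟩
  · have hfb : d ∈ Set.range P.cut → j ≠ if o.dir d then 0 else 1 := by
      rintro ⟨i, rfl⟩ h; exact hover (.firstBack i) (by simp [overSegment, h])
    have hff : d ∈ Set.range P.cut → j ≠ if o.dir d then 1 else 2 := by
      rintro ⟨i, rfl⟩ h; exact hunder (.firstFront i) (by simp [underSegment, h])
    have hsb : P.rot d ∈ Set.range P.cut → j ≠ if o.dir d then 3 else 4 := by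
      rintro ⟨i, hi⟩ h; exact hover (.secondBack i) (by simp [overSegment, hi, h])
    have hsf : P.rot d ∈ Set.range P.cut → j ≠ if o.dir d then 2 else 3 := by
      rintro ⟨i, hi⟩ h; exact hunder (.secondFront i) (by simp [underSegment, hi, h])
    cases h : o.dir d
    · obtain ⟨h4, h3, h2, h1, h0⟩ := next_strand_of_not_dir h
      rw [h] at hfb hff hsb hsf
      have hj0 : j ≠ 0 := by
        rintro rfl
        exact hs (firstIn_of_not_dir h ▸ (edge_mem_range o d.1).1)
      fin_cases j <;> simp_all [numbering]
    · obtain ⟨h1, h2, h3, h4, h0⟩ := next_strand_of_dir h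
      rw [h] at hfb hff hsb hsf
      have hj0 : j ≠ 4 := by
        rintro rfl
        exact hs (secondIn_of_dir h ▸ (edge_mem_range o (P.rot d).1).2)
      fin_cases j <;> simp_all [numbering]
  · have hjk : j = 2 * P.k := by
      by_contra hne
      rcases Nat.even_or_odd' j with ⟨i, rfl | rfl⟩
      · exact hover (.firstFront ⟨i, by omega⟩) rfl
      · exact hover (.secondFront ⟨i, by omega⟩) rfl
    simp [nextSegment, numbering, hjk]
  · have hjk : j = 0 := by
      by_contra hne
      rcases Nat.even_or_odd' j with ⟨i, rfl | rfl⟩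
      · obtain ⟨i, rfl⟩ := Nat.exists_eq_succ_of_ne_zero (show i ≠ 0 by omega)
        exact hunder (.secondBack ⟨i, by omega⟩) rfl
      · exact hunder (.firstBack ⟨i, by omega⟩) rfl
    simp [nextSegment, numbering, hjk]

variable {PV PR}

attribute [local simp] encircledLink_next encircledLink_overIn
  encircledLink_underIn encircledLink_sign component_strand component_front component_back
  start_rot_symm

theorem NumbersFaces.numbersCrossing_edge (h : NumbersFaces o PV PR) (e : E) :
    (encircledLink o).NumbersCrossing (numbering o PV PR) (.edge e) := by
  obtain ⟨d₁, d₂, rfl, hd₁, hd₂, h₁, h₂, hsign⟩ := exists_strands o e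
  have hrev : o.dir (Dart.rev d₁) = true := by rw [o.dir_first, hd₁]; rfl
  have hrot : o.dir (P.rot.symm (Dart.rev (P.rot d₂))) = false := by
    rw [dir_rot_symm_rev_rot, hd₂]; rfl
  have hnext₁ := (next_strand_of_not_dir hd₁).2.2.2.2
  have hnext₂ := (next_strand_of_dir hd₂).2.2.2.2
  rcases hsign with ⟨hd, hsign⟩ | ⟨hd, hsign⟩
  · have hpair : (encircledLink o).NumbersPair (numbering o PV PR) (firstIn o d₁.1)
        (secondIn o d₁.1) := by
      have hleft₁ := h.of_dir hrev
      have hleft₂ := h.of_dir hd₂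
      rw [strandComponent_rev] at hleft₁
      rw [P.left_corner, ← P.start_rot, hd] at hleft₂
      rw [hd] at hrot hnext₂
      simp [LinkDiagram.NumbersPair, numbering, h₁, h₂, hnext₁, hnext₂, hd₁, hd₂, hrev, hrot,
        P.left_corner d₂, hd, hleft₁, hleft₂]
    rcases Int.units_eq_one_or (G.sign d₁.1) with hG | hG <;>
      simp [LinkDiagram.NumbersCrossing, overSegment, underSegment, hsign, hG, hpair]
  · have hpair : (encircledLink o).NumbersPair (numbering o PV PR) (secondIn o d₁.1)
        (firstIn o d₁.1) := by
      have hleft₁ := h.of_not_dir hd₁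
      have hleft₂ := h.of_not_dir hrot
      rw [strandComponent_rot_symm_rev, Equiv.symm_apply_apply, P.left_rot_symm,
        P.start_rot_symm, hd, Dart.rev_rev] at hleft₂
      rw [hd, Dart.rev_rev] at hrot hnext₂
      simp [LinkDiagram.NumbersPair, numbering, h₁, h₂, hnext₁, hnext₂, hd₁, hd₂, hrev, hrot,
        P.left_corner d₂, hd, hleft₁, hleft₂, Dart.rev_rev]
    rcases Int.units_eq_one_or (G.sign d₁.1) with hG | hG <;>
      simp [LinkDiagram.NumbersCrossing, overSegment, underSegment, hsign, hG, hpair]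

attribute [local simp] LinkDiagram.NumbersCrossing LinkDiagram.NumbersPair crossingSign overSegment
  underSegment numbering alongPath_start_cut alongPath_left_cut alongPath_left_rot_symm_cut

theorem NumbersFaces.numbersCrossing_firstFront (h : NumbersFaces o PV PR) (i : Fin P.k) :
    (encircledLink o).NumbersCrossing (numbering o PV PR) (.firstFront i) := by
  have hcircle := nextSegment_front o (P := P) (j := 2 * i) (by lia)
  cases hd : o.dir (P.cut i)
  · obtain ⟨-, -, hnext, -⟩ := next_strand_of_not_dir hd
    have hface := h.of_not_dir hd
    simp [hd, hnext, hcircle, hface]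
  · obtain ⟨-, hnext, -⟩ := next_strand_of_dir hd
    have hface := h.of_dir hd
    simp [hd, hnext, hcircle, hface]

theorem NumbersFaces.numbersCrossing_firstBack (h : NumbersFaces o PV PR) (i : Fin P.k) :
    (encircledLink o).NumbersCrossing (numbering o PV PR) (.firstBack i) := by
  have hcircle := nextSegment_back o (P := P) (j := 2 * i) (by lia)
  cases hd : o.dir (P.cut i)
  · obtain ⟨-, -, -, hnext, -⟩ := next_strand_of_not_dir hd
    have hface := h.of_not_dir hd
    simp [hd, hnext, hcircle, hface]
  · obtain ⟨hnext, -⟩ := next_strand_of_dir hd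
    have hface := h.of_dir hd
    simp [hd, hnext, hcircle, hface]

theorem NumbersFaces.numbersCrossing_secondFront (h : NumbersFaces o PV PR) (i : Fin P.k) :
    (encircledLink o).NumbersCrossing (numbering o PV PR) (.secondFront i) := by
  have hcircle := nextSegment_front o (P := P) (j := 2 * i + 1) (by lia)
  cases hd : o.dir (P.rot.symm (P.cut i))
  · obtain ⟨-, hnext, -⟩ := next_strand_of_not_dir hd
    have hface := h.of_not_dir hd
    rw [P.start_rot_symm] at hface
    simp [hd, hnext, hcircle, hface]
  · obtain ⟨-, -, hnext, -⟩ := next_strand_of_dir hd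
    have hface := h.of_dir hd
    rw [P.start_rot_symm] at hface
    simp [hd, hnext, hcircle, hface]

theorem NumbersFaces.numbersCrossing_secondBack (h : NumbersFaces o PV PR) (i : Fin P.k) :
    (encircledLink o).NumbersCrossing (numbering o PV PR) (.secondBack i) := by
  have hcircle := nextSegment_back o (P := P) (j := 2 * i + 1) (by lia)
  cases hd : o.dir (P.rot.symm (P.cut i))
  · obtain ⟨hnext, -⟩ := next_strand_of_not_dir hd
    have hface := h.of_not_dir hd
    rw [P.start_rot_symm] at hface
    simp [hd, hnext, hcircle, hface]
  · obtain ⟨-, -, -, hnext, -⟩ := next_strand_of_dir hd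
    have hface := h.of_dir hd
    rw [P.start_rot_symm] at hface
    simp [hd, hnext, hcircle, hface]

theorem exists_numbering : ∃ lab, (encircledLink o).IsNumbering lab := by
  obtain ⟨PV, PR, h⟩ := exists_numbersFaces o
  refine ⟨numbering o PV PR, fun s hs => numbering_nextSegment o PV PR hs, ?_⟩
  rintro (e | i | i | i | i)
  · exact h.numbersCrossing_edge o e
  · exact h.numbersCrossing_firstFront o i
  · exact h.numbersCrossing_firstBack o i
  · exact h.numbersCrossing_secondFront o i
  · exact h.numbersCrossing_secondBack o i

end Numbering

end AnnularEmbedding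

/-! ### Potentials twisted along `γ` -/

namespace AnnularEmbedding

section TwistedPotential

variable {V E R : Type*} [Fintype V] [Fintype E] [Fintype R] {G : PeriodicGraph V E}

section

variable (P : AnnularEmbedding G R)

/-- The directed edge `d` is followed by `face d` on the boundary of the region to its left. -/
def face : Equiv.Perm (E × Bool) := Dart.revEquiv.trans P.rot.symm

theorem face_apply (d : E × Bool) : P.face d = P.rot.symm (Dart.rev d) := rfl

theorem face_rev (d : E × Bool) : P.face (Dart.rev d) = P.rot.symm d := by
  rw [face_apply, Dart.rev_rev]

theorem left_face (d : E × Bool) : P.left (P.face d) = P.left d := by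
  rw [face_apply, left_rot_symm, Dart.rev_rev]

theorem left_eq_of_sameCycle_face {d d' : E × Bool} (h : P.face.SameCycle d d') :
    P.left d = P.left d' := by
  obtain ⟨n, rfl⟩ := h.exists_nat_pow_eq
  induction n with
  | zero => rfl
  | succ n ih => rw [pow_succ', Equiv.Perm.mul_apply, left_face, ih ⟨n, by simp⟩]

variable {P}

theorem rev_cut_ne (i j : Fin P.k) : Dart.rev (P.cut i) ≠ P.cut j := by
  intro h
  have hi := P.right_cut i
  have hj := P.right_cut j
  rw [h, P.left_cut] at hi
  rw [← h, Dart.rev_rev, P.left_cut] at hj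
  have hi := congrArg Fin.val (P.path_injective hi)
  have hj := congrArg Fin.val (P.path_injective hj)
  simp only [Fin.val_castSucc, Fin.val_succ] at hi hj
  lia

theorem cut_cases {p : E × Bool → Prop} (cut : ∀ i, p (P.cut i))
    (rev_cut : ∀ i, p (Dart.rev (P.cut i)))
    (of_notMem : ∀ d, d ∉ Set.range P.cut → Dart.rev d ∉ Set.range P.cut → p d) (d : E × Bool) :
    p d := by
  by_cases hd : d ∈ Set.range P.cut
  · obtain ⟨i, rfl⟩ := hd
    exact cut i
  by_cases hd' : Dart.rev d ∈ Set.range P.cut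
  · obtain ⟨i, hi⟩ := hd'
    rw [← Dart.rev_rev d, ← hi]
    exact rev_cut i
  · exact of_notMem d hd hd'

end

variable (P : AnnularEmbedding G R) {A W : Type*} [CommRing A] [AddCommGroup W] [Module A W]

open Classical in
/-- The holonomy of the crossings of `γ` with the first half of a directed edge. -/
def twist (x : Aˣ) (d : E × Bool) : Aˣ := if d ∈ Set.range P.cut then x else 1

theorem twist_cut (x : Aˣ) (i : Fin P.k) : P.twist x (P.cut i) = x := if_pos ⟨i, rfl⟩

theorem twist_of_notMem (x : Aˣ) {d : E × Bool} (hd : d ∉ Set.range P.cut) : P.twist x d = 1 :=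
  if_neg hd

theorem twist_rev_cut (x : Aˣ) (i : Fin P.k) : P.twist x (Dart.rev (P.cut i)) = 1 :=
  P.twist_of_notMem x fun ⟨j, hj⟩ => rev_cut_ne i j hj.symm

/-- The total of `f` over the edges that `γ` crosses before it reaches the region `path n`. -/
def flux (f : E × Bool → W) (n : Fin (P.k + 1)) : W :=
  ∑ i : Fin P.k with i.castSucc < n, f (P.cut i)

theorem flux_zero (f : E × Bool → W) : P.flux f 0 = 0 := by simp [flux]

theorem flux_succ (f : E × Bool → W) (i : Fin P.k) :
    P.flux f i.succ = P.flux f i.castSucc + f (P.cut i) := by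
  simp only [flux, Fin.castSucc_lt_succ_iff, Fin.castSucc_lt_castSucc_iff]
  rw [Finset.filter_ge_eq_Iic, Finset.filter_gt_eq_Iio, ← Finset.Iio_insert,
    Finset.sum_insert (by simp), add_comm]

theorem flux_last (f : E × Bool → W) : P.flux f (Fin.last P.k) = ∑ i, f (P.cut i) := by
  simp [flux, Fin.castSucc_lt_last]

theorem flux_mem_span (f : E × Bool → W) (n : Fin (P.k + 1)) :
    P.flux f n ∈ Submodule.span A (Set.range f) :=
  Submodule.sum_mem _ fun i _ => Submodule.subset_span ⟨P.cut i, rfl⟩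

/-- A function `f` on the directed edges is a twisted flow with stream function `m` if it is
antisymmetric and `m`, a function on the corners, jumps across every directed edge by the
corresponding value of `f`, multiplied by the holonomy. -/
structure IsTwistedFlow (x : Aˣ) (m f : E × Bool → W) : Prop where
  rev (d : E × Bool) : f (Dart.rev d) = -f d
  sub_eq (d : E × Bool) : m d - m (P.rot.symm d) = P.twist x d • f d

section Conservation

open Classical in
theorem sum_sub_rot_symm_eq_zero (m : E × Bool → W) {Z : Type*} (w : V → Z) (β : Z) :
    ∑ d with w (G.start d) = β, (m d - m (P.rot.symm d)) = 0 := by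
  rw [Finset.sum_sub_distrib, sub_eq_zero, Finset.sum_filter, Finset.sum_filter,
    ← Equiv.sum_comp P.rot.symm]
  simp only [start_rot_symm]

open Classical in
theorem sum_eq_zero_of_rev {f : E × Bool → W} (hf : ∀ d, f (Dart.rev d) = -f d)
    {p : E × Bool → Prop} (hp : ∀ d, p (Dart.rev d) ↔ p d) : ∑ d with p d, f d = 0 := by
  rw [Finset.sum_filter, Fintype.sum_prod_type]
  refine Finset.sum_eq_zero fun e _ => ?_
  have hfe := hf (e, true)
  have hpe := hp (e, true)
  rw [Dart.rev, Bool.not_true] at hfe hpe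
  simp only [Fintype.sum_bool, hfe, hpe]
  split_ifs <;> simp

open Classical in
theorem sum_twist_smul (x : Aˣ) (f : E × Bool → W) (s : Finset (E × Bool)) :
    ∑ d ∈ s, P.twist x d • f d =
      ∑ d ∈ s, f d + ((x : A) - 1) • ∑ i with P.cut i ∈ s, f (P.cut i) := by
  have htwist : ∀ d, P.twist x d • f d =
      f d + ∑ i, if P.cut i = d then ((x : A) - 1) • f (P.cut i) else 0 := fun d => by
    by_cases hd : d ∈ Set.range P.cut
    · obtain ⟨j, rfl⟩ := hd
      simp [twist_cut, P.cut_injective.eq_iff, Units.smul_def, sub_smul]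
    · rw [P.twist_of_notMem x hd, Finset.sum_eq_zero fun i _ => if_neg fun h => hd ⟨i, h⟩]
      simp
  simp only [htwist, Finset.sum_add_distrib]
  rw [Finset.sum_comm, Finset.smul_sum, Finset.sum_filter]
  simp

variable {P} {x : Aˣ} {m f : E × Bool → W}

open Classical in
theorem IsTwistedFlow.smul_sum_cut_eq_zero (h : P.IsTwistedFlow x m f) {Z : Type*} {w : V → Z}
    (hw : ∀ d, w (G.start (Dart.rev d)) = w (G.start d)) (β : Z) :
    ((x : A) - 1) • ∑ i with w (G.start (P.cut i)) = β, f (P.cut i) = 0 := by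
  have hsum := P.sum_sub_rot_symm_eq_zero m w β
  simp only [h.sub_eq, sum_twist_smul, Finset.mem_filter_univ] at hsum
  rwa [sum_eq_zero_of_rev h.rev fun d => by rw [hw], zero_add] at hsum

theorem IsTwistedFlow.smul_flux_last (h : P.IsTwistedFlow x m f) :
    ((x : A) - 1) • P.flux f (Fin.last P.k) = 0 := by
  simpa only [flux_last, Finset.filter_true] using
    h.smul_sum_cut_eq_zero (w := fun _ => ()) (fun _ => rfl) ()

theorem exists_potential_of_apply_face {c : E × Bool → W} (hc : ∀ d, c (P.face d) = c d) :
    ∃ (w : V → W) (u : R → W), (∀ d, c d = w (G.start d) + u (P.left d)) ∧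
      ∀ d, w (G.start (Dart.rev d)) = w (G.start d) := by
  obtain ⟨w, u, hwu⟩ := P.exists_potential (c := c) fun e => by
    have htrue := hc (e, true)
    have hfalse := hc (e, false)
    rw [face_apply, Dart.rev, Bool.not_true] at htrue
    rw [face_apply, Dart.rev, Bool.not_false] at hfalse
    rw [htrue, hfalse, add_comm]
  refine ⟨w, u, hwu, fun d => ?_⟩
  have hd := hc d
  rwa [hwu, hwu, left_face, face_apply, P.start_rot_symm, add_left_inj] at hd

theorem sameCycle_face_cut_iff {i j : Fin P.k} :
    P.face.SameCycle (P.cut i) (P.cut j) ↔ i = j := by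
  refine ⟨fun h => ?_, fun h => h ▸ .refl _ _⟩
  have hleft := P.left_eq_of_sameCycle_face h
  rwa [P.left_cut, P.left_cut, P.path_injective.eq_iff, Fin.castSucc_inj] at hleft

theorem succ_eq_of_sameCycle_face {i j : Fin P.k}
    (h : P.face.SameCycle (Dart.rev (P.cut i)) (P.cut j)) : i.succ = j.castSucc := by
  have hleft := P.left_eq_of_sameCycle_face h
  rwa [P.right_cut, P.left_cut, P.path_injective.eq_iff] at hleft

/-- If `γ` enters and leaves a region through different boundary components, the part of the graph
that it meets before is disjoint from the part that it meets afterwards. -/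
theorem exists_separation_of_not_sameCycle {i j : Fin P.k} (hij : i.succ = j.castSucc)
    (h : ¬P.face.SameCycle (Dart.rev (P.cut i)) (P.cut j)) :
    ∃ (w : V → ℤ) (β : ℤ), (∀ d, w (G.start (Dart.rev d)) = w (G.start d)) ∧
      ∀ l, w (G.start (P.cut l)) = β ↔ l.castSucc < i.succ := by
  classical
  obtain ⟨w, u, hwu, hw⟩ := P.exists_potential_of_apply_face
    (c := fun d => if P.face.SameCycle d (P.cut j) then (1 : ℤ) else 0)
    fun d => by simp only [Equiv.Perm.sameCycle_apply_left]
  have hrev : ∀ l, ¬P.face.SameCycle (Dart.rev (P.cut l)) (P.cut j) := fun l hl =>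
    h (Fin.succ_injective _ ((succ_eq_of_sameCycle_face hl).trans hij.symm) ▸ hl)
  have hstart : ∀ l, w (G.start (P.cut l)) = -u (P.path l.succ) := fun l => by
    have hl := hwu (Dart.rev (P.cut l))
    rw [if_neg (hrev l), hw, P.right_cut] at hl
    linarith
  have hu : ∀ n, u (P.path n) = u (P.path 0) - if j.castSucc < n then 1 else 0 := fun n => by
    induction n using Fin.induction with
    | zero => simp
    | succ l ih =>
      have hl := hwu (P.cut l)
      rw [hstart, P.left_cut, ih] at hl
      grind [sameCycle_face_cut_iff, Fin.castSucc_lt_succ_iff, Fin.castSucc_lt_castSucc_iff]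
  refine ⟨w, -u (P.path 0), hw, fun l => ?_⟩
  rw [hstart, hu, hij, Fin.castSucc_lt_castSucc_iff]
  grind [Fin.castSucc_lt_succ_iff]

theorem IsTwistedFlow.smul_flux_succ_of_not_sameCycle (hflow : P.IsTwistedFlow x m f)
    {i j : Fin P.k} (hij : i.succ = j.castSucc)
    (h : ¬P.face.SameCycle (Dart.rev (P.cut i)) (P.cut j)) :
    ((x : A) - 1) • P.flux f i.succ = 0 := by
  obtain ⟨w, β, hw, hβ⟩ := exists_separation_of_not_sameCycle hij h
  simpa only [flux, hβ] using hflow.smul_sum_cut_eq_zero hw β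

end Conservation

section Correction

/-- `η` is supported on the boundaries of the regions `path n`. It equals `c n` on the stretch of
the boundary of `path n` from the edge where `γ` enters this region to the edge where `γ` leaves it,
and vanishes on the complementary stretch. -/
structure IsCorrection (c : Fin (P.k + 1) → W) (η : E × Bool → W) : Prop where
  face (d : E × Bool) (hd : d ∉ Set.range P.cut) (hd' : Dart.rev d ∉ Set.range P.cut) :
    η (P.face d) = η d
  cut (i : Fin P.k) : η (P.cut i) = c i.castSucc
  face_cut (i : Fin P.k) : η (P.face (P.cut i)) = 0
  rev_cut (i : Fin P.k) : η (Dart.rev (P.cut i)) = 0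
  rot_symm_cut (i : Fin P.k) : η (P.rot.symm (P.cut i)) = c i.succ
  eq_zero_or (d : E × Bool) : η d = 0 ∨ ∃ n, η d = c n

variable {P}

theorem exists_correction_at {n : Fin (P.k + 1)} {a : W}
    (ha : a ≠ 0 → ∃ i j : Fin P.k, i.succ = n ∧ j.castSucc = n ∧
      P.face.SameCycle (Dart.rev (P.cut i)) (P.cut j)) :
    ∃ η : E × Bool → W,
      (∀ d, d ∉ Set.range P.cut → Dart.rev d ∉ Set.range P.cut → η (P.face d) = η d) ∧
      (∀ i : Fin P.k, i.castSucc = n → η (P.cut i) = a ∧ η (P.face (P.cut i)) = 0) ∧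
      (∀ i : Fin P.k, i.succ = n → η (Dart.rev (P.cut i)) = 0 ∧ η (P.rot.symm (P.cut i)) = a) ∧
      ∀ d, η d = 0 ∨ η d = a := by
  classical
  by_cases ha₀ : a = 0
  · exact ⟨0, by simp [ha₀]⟩
  obtain ⟨i, j, rfl, hj, hs⟩ := ha ha₀
  obtain ⟨T, hcut, hface_cut, hrev_cut, hface_rev_cut, hface⟩ :=
    exists_set_of_sameCycle hs (rev_cut_ne _ _)
  rw [face_rev] at hface_rev_cut
  refine ⟨T.indicator fun _ => a, fun d hd hd' => ?_, fun l hl => ?_, fun l hl => ?_, fun d => ?_⟩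
  · simp only [Set.indicator_apply,
      hface d (fun h => hd' ⟨i, by rw [h, Dart.rev_rev]⟩) fun h => hd ⟨j, h.symm⟩]
  · obtain rfl := Fin.castSucc_injective _ (hl.trans hj.symm)
    exact ⟨Set.indicator_of_mem hcut _, Set.indicator_of_notMem hface_cut _⟩
  · obtain rfl := Fin.succ_injective _ hl
    exact ⟨Set.indicator_of_notMem hrev_cut _, Set.indicator_of_mem hface_rev_cut _⟩
  · exact Set.indicator_eq_zero_or_self T (fun _ => a) d

theorem exists_isCorrection {c : Fin (P.k + 1) → W}
    (hc : ∀ n, c n ≠ 0 → ∃ i j : Fin P.k, i.succ = n ∧ j.castSucc = n ∧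
      P.face.SameCycle (Dart.rev (P.cut i)) (P.cut j)) : ∃ η, P.IsCorrection c η := by
  choose η hface hcut hrev hzero using fun n => exists_correction_at (hc n)
  let η' : E × Bool → W := fun d => Function.extend P.path (fun n => η n d) 0 (P.left d)
  have hη : ∀ d n, P.left d = P.path n → η' d = η n d := fun d n hd => by
    simp only [η', hd, P.path_injective.extend_apply]
  have hη₀ : ∀ d, P.left d ∉ Set.range P.path → η' d = 0 := fun d hd =>
    Function.extend_apply' _ _ _ hd
  have hleft : ∀ i, P.left (P.rot.symm (P.cut i)) = P.path i.succ := fun i => by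
    rw [left_rot_symm, P.right_cut]
  refine ⟨η', fun d hd hd' => ?_, fun i => ?_, fun i => ?_, fun i => ?_, fun i => ?_, fun d => ?_⟩
  · by_cases h : P.left d ∈ Set.range P.path
    · obtain ⟨n, hn⟩ := h
      rw [hη d n hn.symm, hη _ n ((P.left_face d).trans hn.symm), hface n d hd hd']
    · rw [hη₀ d h, hη₀ _ (by rwa [left_face])]
  · rw [hη _ _ (P.left_cut i), (hcut _ i rfl).1]
  · rw [hη _ _ ((P.left_face _).trans (P.left_cut i)), (hcut _ i rfl).2]
  · rw [hη _ _ (P.right_cut i), (hrev _ i rfl).1]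
  · rw [hη _ _ (hleft i), (hrev _ i rfl).2]
  · by_cases h : P.left d ∈ Set.range P.path
    · obtain ⟨n, hn⟩ := h
      rw [hη d n hn.symm]
      exact (hzero n d).imp_right fun h => ⟨n, h⟩
    · exact .inl (hη₀ d h)

variable {x : Aˣ} {m f η : E × Bool → W}

theorem IsTwistedFlow.exists_isCorrection (h : P.IsTwistedFlow x m f) :
    ∃ η, P.IsCorrection (fun n => (1 - (x : A)) • P.flux f n) η := by
  refine AnnularEmbedding.exists_isCorrection fun n hn => ?_
  have hn : ((x : A) - 1) • P.flux f n ≠ 0 := by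
    rwa [← neg_sub, neg_smul, neg_ne_zero] at hn
  obtain rfl | ⟨i, rfl⟩ := n.eq_zero_or_eq_succ
  · exact absurd (by rw [flux_zero, smul_zero]) hn
  obtain hi | ⟨j, hj⟩ := i.succ.eq_castSucc_or_eq_last.symm
  · exact absurd (hi ▸ h.smul_flux_last) hn
  · refine ⟨i, j, rfl, hj.symm, not_imp_comm.1 (fun hs => ?_) hn⟩
    exact h.smul_flux_succ_of_not_sameCycle hj hs

theorem IsCorrection.mem_span
    (hη : P.IsCorrection (fun n => (1 - (x : A)) • P.flux f n) η) (d : E × Bool) :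
    η d ∈ Submodule.span A (Set.range f) := by
  obtain h | ⟨n, h⟩ := hη.eq_zero_or d
  · exact h ▸ Submodule.zero_mem _
  · exact h ▸ Submodule.smul_mem _ _ (P.flux_mem_span f n)

theorem IsTwistedFlow.sub_correction_balanced (h : P.IsTwistedFlow x m f)
    (hη : P.IsCorrection (fun n => (1 - (x : A)) • P.flux f n) η) (d : E × Bool) :
    (m d - η d) + (m (Dart.rev d) - η (Dart.rev d)) =
      (m (P.rot.symm d) - η (P.rot.symm d)) +
        (m (P.rot.symm (Dart.rev d)) - η (P.rot.symm (Dart.rev d))) := by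
  have hjump : ∀ d, m d = m (P.rot.symm d) + P.twist x d • f d := fun d => by
    rw [← h.sub_eq, add_sub_cancel]
  have hcut : ∀ i, (m (P.cut i) - η (P.cut i)) +
      (m (Dart.rev (P.cut i)) - η (Dart.rev (P.cut i))) =
      (m (P.rot.symm (P.cut i)) - η (P.rot.symm (P.cut i))) +
        (m (P.face (P.cut i)) - η (P.face (P.cut i))) := fun i => by
    rw [hjump (P.cut i), hjump (Dart.rev _), twist_cut, twist_rev_cut, h.rev, hη.cut, hη.rev_cut,
      hη.rot_symm_cut, hη.face_cut, flux_succ, Units.smul_def, one_smul, face_apply]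
    module
  induction d using P.cut_cases with
  | cut i => exact hcut i
  | rev_cut i =>
    rw [Dart.rev_rev, add_comm, hcut i, add_comm, face_apply]
  | of_notMem d hd hd' =>
    have hrev := hη.face (Dart.rev d) hd' (by rwa [Dart.rev_rev])
    rw [face_rev] at hrev
    rw [hjump d, hjump (Dart.rev d), P.twist_of_notMem x hd, P.twist_of_notMem x hd', h.rev,
      one_smul, one_smul, ← face_apply, hη.face d hd hd', hrev, face_apply]
    module

theorem IsTwistedFlow.apply_path (h : P.IsTwistedFlow x m f)
    (hη : P.IsCorrection (fun n => (1 - (x : A)) • P.flux f n) η) {w : V → W} {u : R → W}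
    (hwu : ∀ d, m d - η d = w (G.start d) + u (P.left d)) (n : Fin (P.k + 1)) :
    u (P.path n) = u (P.path 0) - P.flux f n := by
  have hstep : ∀ i : Fin P.k, u (P.path i.castSucc) - u (P.path i.succ) = f (P.cut i) := fun i => by
    have hm := h.sub_eq (P.cut i)
    have hcut := hwu (P.cut i)
    have hrot := hwu (P.rot.symm (P.cut i))
    rw [hη.cut, P.left_cut, sub_eq_iff_eq_add] at hcut
    rw [hη.rot_symm_cut, P.start_rot_symm, left_rot_symm, P.right_cut, sub_eq_iff_eq_add] at hrot
    rw [hcut, hrot, twist_cut, Units.smul_def, flux_succ, ← sub_eq_zero] at hm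
    rw [← sub_eq_zero, ← hm]
    module
  induction n using Fin.induction with
  | zero => rw [flux_zero, sub_zero]
  | succ i ih => rw [flux_succ, ← sub_sub, ← ih, ← hstep, sub_sub_cancel]

theorem IsCorrection.twist_inv_smul_eq
    (hη : P.IsCorrection (fun n => (1 - (x : A)) • P.flux f n) η) {u : R → W}
    (hu : ∀ n, u (P.path n) = -P.flux f n) (d : E × Bool) :
    (P.twist x d)⁻¹ • (u (P.left d) + η d) =
      (P.twist x (Dart.rev d))⁻¹ • (u (P.left d) + η (P.face d)) := by
  induction d using P.cut_cases with
  | cut i =>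
    rw [twist_cut, twist_rev_cut, P.left_cut, hη.cut, hη.face_cut, hu, inv_one, one_smul,
      inv_smul_eq_iff, Units.smul_def]
    module
  | rev_cut i =>
    rw [Dart.rev_rev, twist_cut, twist_rev_cut, P.right_cut, hη.rev_cut, face_rev, hη.rot_symm_cut,
      hu, inv_one, one_smul, eq_inv_smul_iff, Units.smul_def]
    module
  | of_notMem d hd hd' =>
    rw [P.twist_of_notMem x hd, P.twist_of_notMem x hd', hη.face d hd hd']

/-- This is the vanishing of the first cohomology with twisted coefficients: up to functions on the
vertices, `m` is a parallel section `ρ` along the boundary of every region. -/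
theorem IsTwistedFlow.exists_potential (h : P.IsTwistedFlow x m f) :
    ∃ (w : V → W) (ρ : E × Bool → W) (u : R → W), u (P.path 0) = 0 ∧
      (∀ d, m d = w (G.start d) + ρ d) ∧
      (∀ d, (P.twist x d)⁻¹ • ρ d = (P.twist x (Dart.rev d))⁻¹ • ρ (P.face d)) ∧
      ∀ d, ρ d - u (P.left d) ∈ Submodule.span A (Set.range f) := by
  obtain ⟨η, hη⟩ := h.exists_isCorrection
  obtain ⟨w, u, hwu⟩ := P.exists_potential (c := fun d => m d - η d) fun e =>
    h.sub_correction_balanced hη (e, true)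
  refine ⟨fun v => w v + u (P.path 0), fun d => u (P.left d) - u (P.path 0) + η d,
    fun r => u r - u (P.path 0), sub_self _, fun d => ?_, fun d => ?_, fun d => ?_⟩
  · rw [← sub_add_cancel (m d) (η d), hwu]
    dsimp only
    abel
  · simp only [left_face]
    refine hη.twist_inv_smul_eq (u := fun r => u r - u (P.path 0)) (fun n => ?_) d
    rw [h.apply_path hη hwu, sub_sub_cancel_left]
  · rw [add_sub_cancel_left]
    exact hη.mem_span d

end Correction

end TwistedPotential

end AnnularEmbedding

/-! ### Colorings of the encircled link -/

namespace LinkDiagram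

variable {S X W : Type*} (D : LinkDiagram S X)

theorem apply_underRight_add_apply_underLeft [AddCommMonoid W] (α : S → W) (c : X) :
    α (D.underRight c) + α (D.underLeft c) = α (D.underIn c) + α (D.next (D.underIn c)) := by
  unfold underRight underLeft
  split_ifs
  · rfl
  · exact add_comm _ _

/-- Where the overpassing meridian acts as `-1`, the relation is symmetric in the two sides, so that
it does not depend on the orientations. -/
theorem relation_iff_of_meridian_overIn_eq_neg_one {A : Type*} [CommRing A] [AddCommGroup W]
    [Module A W] (φ : MvLaurent D.Component →+* A) (w : D.Arc → W) (c : X)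
    (h : φ (D.meridian (D.overIn c)) = -1) :
    w (D.arc (D.underRight c)) + (φ (D.meridian (D.underIn c)) - 1) • w (D.arc (D.overIn c)) =
        φ (D.meridian (D.overIn c)) • w (D.arc (D.underLeft c)) ↔
      w (D.arc (D.underIn c)) + w (D.arc (D.next (D.underIn c))) =
        (1 - φ (D.meridian (D.underIn c))) • w (D.arc (D.overIn c)) := by
  rw [h, ← D.apply_underRight_add_apply_underLeft (fun s => w (D.arc s)) c, ← sub_eq_zero,
    ← sub_eq_zero (b := (1 - φ _) • _)]
  apply Eq.congr_left
  module

/-- The function `α` on the segments is constant along the arcs of the diagram. -/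
def IsConstantOnArcs (α : S → W) : Prop := ∀ s ∉ Set.range D.underIn, α (D.next s) = α s

variable {D}

theorem isConstantOnArcs_comp_arc (a : D.Arc → W) : D.IsConstantOnArcs fun s => a (D.arc s) :=
  fun _ hs => congrArg a (D.arc_next hs)

theorem IsConstantOnArcs.exists_apply_arc {α : S → W} (h : D.IsConstantOnArcs α) :
    ∃ a : D.Arc → W, ∀ s, a (D.arc s) = α s :=
  ⟨Quot.lift α (by rintro _ _ ⟨rfl, hs⟩; exact (h _ hs).symm), fun _ => rfl⟩

end LinkDiagram

namespace AnnularEmbedding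

variable {V E R : Type*} [Fintype V] [Fintype E] [Fintype R] {G : PeriodicGraph V E}
  {P : AnnularEmbedding G R} (o : P.Orientation)

theorem strand_mem_range_underSegment_iff (d : E × Bool) (j : Fin 5) :
    (.strand d j : P.Segment) ∈ Set.range (underSegment o) ↔
      (d ∈ Set.range P.cut ∧ j = if o.dir d then 1 else 2) ∨
      (P.rot d ∈ Set.range P.cut ∧ j = if o.dir d then 2 else 3) ∨
      (o.dir d = false ∧ j = 0 ∧ G.sign d.1 ≠ 1) ∨
      (o.dir d = true ∧ j = 4 ∧ G.sign (P.rot d).1 = 1) := by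
  constructor
  · rintro ⟨e | i | i | i | i, h⟩ <;> simp only [underSegment, reduceCtorEq] at h
    · obtain ⟨d₁, d₂, rfl, h₁, h₂, hfirst, hsecond, hrot⟩ := exists_strands o e
      have hd₂ : (P.rot d₂).1 = d₁.1 := by
        rcases hrot with ⟨hrot, -⟩ | ⟨hrot, -⟩ <;> rw [hrot]
        rfl
      rw [hfirst, hsecond] at h
      split_ifs at h with hs <;> cases h
      · exact .inr (.inr (.inr ⟨h₂, rfl, hd₂ ▸ hs⟩))
      · exact .inr (.inr (.inl ⟨h₁, rfl, hs⟩))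
    · cases h
      exact .inl ⟨⟨i, rfl⟩, rfl⟩
    · cases h
      exact .inr (.inl ⟨⟨i, by simp⟩, rfl⟩)
  · rintro (⟨⟨i, rfl⟩, rfl⟩ | ⟨⟨i, hi⟩, rfl⟩ | ⟨h, rfl, hs⟩ | ⟨h, rfl, hs⟩)
    · exact ⟨.firstFront i, rfl⟩
    · obtain rfl : d = P.rot.symm (P.cut i) := by rw [hi, Equiv.symm_apply_apply]
      exact ⟨.secondFront i, rfl⟩
    · exact ⟨.edge d.1, by rw [← firstIn_of_not_dir h]; simp [underSegment, hs]⟩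
    · exact ⟨.edge (P.rot d).1, by rw [← secondIn_of_dir h]; simp [underSegment, hs]⟩

theorem front_notMem_range_underSegment (j : Fin (2 * P.k + 1)) :
    (.front j : P.Segment) ∉ Set.range (underSegment o) := by
  rintro ⟨e | i | i | i | i, h⟩ <;> simp only [underSegment, reduceCtorEq] at h
  split_ifs at h <;> simp [firstIn, secondIn] at h

theorem back_mem_range_underSegment_iff (j : Fin (2 * P.k + 1)) :
    (.back j : P.Segment) ∈ Set.range (underSegment o) ↔ j ≠ 0 := by
  constructor
  · rintro ⟨e | i | i | i | i, h⟩ rfl <;> simp only [underSegment, reduceCtorEq] at h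
    · split_ifs at h <;> simp [firstIn, secondIn] at h
    all_goals simp [Fin.ext_iff] at h
  · obtain ⟨j, hj⟩ := j
    intro hne
    have hpos : j ≠ 0 := fun h => hne (Fin.ext h)
    rcases Nat.even_or_odd' j with ⟨i, rfl | rfl⟩
    · obtain ⟨i, rfl⟩ := Nat.exists_eq_succ_of_ne_zero (show i ≠ 0 by lia)
      exact ⟨.secondBack ⟨i, by lia⟩, rfl⟩
    · exact ⟨.firstBack ⟨i, by lia⟩, rfl⟩

end AnnularEmbedding

namespace LinkDiagram.IsConstantOnArcs

open AnnularEmbedding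

variable {V E R : Type*} [Fintype V] [Fintype E] [Fintype R] {G : PeriodicGraph V E}
  {P : AnnularEmbedding G R} {o : P.Orientation} {W : Type*} {α : P.Segment → W}
  (h : (encircledLink o).IsConstantOnArcs α)
include h

theorem apply_front (j : Fin (2 * P.k + 1)) : α (.front j) = α (.front 0) := by
  obtain ⟨j, hj⟩ := j
  induction j with
  | zero => rfl
  | succ j ih =>
    rw [← ih (by lia), ← h _ (front_notMem_range_underSegment o ⟨j, by lia⟩)]
    simp [encircledLink_next, nextSegment, show j < 2 * P.k by lia]

theorem apply_back_last : α (.back (Fin.last _)) = α (.front 0) := by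
  rw [← h.apply_front (Fin.last _), ← h _ (front_notMem_range_underSegment o _)]
  simp [encircledLink_next, nextSegment]

theorem apply_back_zero : α (.back 0) = α (.front 0) := by
  have hzero := h (.back 0) fun hs => (back_mem_range_underSegment_iff o 0).1 hs rfl
  simpa [encircledLink_next, nextSegment] using hzero.symm

theorem apply_nextSegment_strand (d : E × Bool) (j : Fin 5)
    (hj : ¬((d ∈ Set.range P.cut ∧ j = if o.dir d then 1 else 2) ∨
      (P.rot d ∈ Set.range P.cut ∧ j = if o.dir d then 2 else 3) ∨
      (o.dir d = false ∧ j = 0 ∧ G.sign d.1 ≠ 1) ∨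
      (o.dir d = true ∧ j = 4 ∧ G.sign (P.rot d).1 = 1))) :
    α (nextSegment o (.strand d j)) = α (.strand d j) :=
  h _ fun hs => hj ((strand_mem_range_underSegment_iff o d j).1 hs)

theorem apply_strand_one (d : E × Bool) : α (.strand d 1) = α (.strand d 0) := by
  cases hd : o.dir d
  · rw [← h.apply_nextSegment_strand d 1 (by simp [hd]), (next_strand_of_not_dir hd).2.2.2.1]
  · rw [← h.apply_nextSegment_strand d 0 (by simp [hd]), (next_strand_of_dir hd).1]

theorem apply_strand_three (d : E × Bool) : α (.strand d 3) = α (.strand d 4) := by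
  cases hd : o.dir d
  · rw [← h.apply_nextSegment_strand d 4 (by simp [hd]), (next_strand_of_not_dir hd).1]
  · rw [← h.apply_nextSegment_strand d 3 (by simp [hd]), (next_strand_of_dir hd).2.2.2.1]

theorem apply_strand_two_of_notMem {d : E × Bool} (hcut : d ∉ Set.range P.cut) :
    α (.strand d 2) = α (.strand d 1) := by
  cases hd : o.dir d
  · rw [← h.apply_nextSegment_strand d 2 (by simp [hd, hcut]), (next_strand_of_not_dir hd).2.2.1]
  · rw [← h.apply_nextSegment_strand d 1 (by simp [hd, hcut]), (next_strand_of_dir hd).2.1]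

theorem apply_strand_two_of_rot_notMem {d : E × Bool} (hcut : P.rot d ∉ Set.range P.cut) :
    α (.strand d 2) = α (.strand d 3) := by
  cases hd : o.dir d
  · rw [← h.apply_nextSegment_strand d 3 (by simp [hd, hcut]), (next_strand_of_not_dir hd).2.1]
  · rw [← h.apply_nextSegment_strand d 2 (by simp [hd, hcut]), (next_strand_of_dir hd).2.2.1]

theorem apply_strand_rev {d : E × Bool} (hs : G.sign d.1 = 1) :
    α (.strand (Dart.rev d) 0) = α (.strand d 0) := by
  have key (d : E × Bool) (hs : G.sign d.1 = 1) (hd : o.dir d = false) :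
      α (.strand (Dart.rev d) 0) = α (.strand d 0) := by
    rw [← h.apply_nextSegment_strand d 0 (by simp [hd, hs]), (next_strand_of_not_dir hd).2.2.2.2]
  cases hd : o.dir d
  · exact key d hs hd
  · simpa only [Dart.rev_rev] using (key (Dart.rev d) hs (by rw [o.dir_first, hd]; rfl)).symm

theorem apply_strand_rot_symm_rev {d : E × Bool} (hs : G.sign d.1 ≠ 1) :
    α (.strand (P.rot.symm (Dart.rev d)) 4) = α (.strand (P.rot.symm d) 4) := by
  have key (d : E × Bool) (hs : G.sign d.1 ≠ 1) (hd : o.dir (P.rot.symm d) = true) :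
      α (.strand (P.rot.symm (Dart.rev d)) 4) = α (.strand (P.rot.symm d) 4) := by
    rw [← h.apply_nextSegment_strand (P.rot.symm d) 4 (by simp [hd, hs]),
      (next_strand_of_dir hd).2.2.2.2, Equiv.apply_symm_apply]
  cases hd : o.dir (P.rot.symm d)
  · simpa only [Dart.rev_rev] using (key (Dart.rev d) hs (by rw [o.dir_second, hd]; rfl)).symm
  · exact key d hs hd

end LinkDiagram.IsConstantOnArcs

namespace AnnularEmbedding

variable {V E R : Type*} [Fintype V] [Fintype E] [Fintype R] {G : PeriodicGraph V E}
  {P : AnnularEmbedding G R} (o : P.Orientation)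

theorem underRight_firstFront (i : Fin P.k) :
    (encircledLink o).underRight (.firstFront i) = .strand (P.cut i) 2 := by
  cases h : o.dir (P.cut i)
  · simp [LinkDiagram.underRight, encircledLink, crossingSign, underSegment, h]
  · simp [LinkDiagram.underRight, encircledLink, crossingSign, underSegment, h,
      next_strand_of_dir h]

theorem underLeft_firstFront (i : Fin P.k) :
    (encircledLink o).underLeft (.firstFront i) = .strand (P.cut i) 1 := by
  cases h : o.dir (P.cut i)
  · simp [LinkDiagram.underLeft, encircledLink, crossingSign, underSegment, h,
      next_strand_of_not_dir h]
  · simp [LinkDiagram.underLeft, encircledLink, crossingSign, underSegment, h]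

theorem underRight_secondFront (i : Fin P.k) :
    (encircledLink o).underRight (.secondFront i) = .strand (P.rot.symm (P.cut i)) 2 := by
  cases h : o.dir (P.rot.symm (P.cut i))
  · simp [LinkDiagram.underRight, encircledLink, crossingSign, underSegment, h,
      next_strand_of_not_dir h]
  · simp [LinkDiagram.underRight, encircledLink, crossingSign, underSegment, h]

theorem underLeft_secondFront (i : Fin P.k) :
    (encircledLink o).underLeft (.secondFront i) = .strand (P.rot.symm (P.cut i)) 3 := by
  cases h : o.dir (P.rot.symm (P.cut i))
  · simp [LinkDiagram.underLeft, encircledLink, crossingSign, underSegment, h]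
  · simp [LinkDiagram.underLeft, encircledLink, crossingSign, underSegment, h,
      next_strand_of_dir h]

theorem nextSegment_underSegment_firstBack (i : Fin P.k) :
    nextSegment o (underSegment o (.firstBack i)) = .back ⟨2 * i, by lia⟩ := by
  simp [underSegment, nextSegment]

theorem nextSegment_underSegment_secondBack (i : Fin P.k) :
    nextSegment o (underSegment o (.secondBack i)) = .back ⟨2 * i + 1, by lia⟩ := by
  simp [underSegment, nextSegment]

/-- The unit `x` of the ring of Laurent polynomials. -/
def unitX : ℤ[T;T⁻¹]ˣ := (LaurentPolynomial.isUnit_T (R := ℤ) 1).unit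

theorem specialize_var_circle :
    specialize o (MvLaurent.var (circle o) : MvLaurent (encircledLink o).Component) = unitX := by
  rw [specialize, MvLaurent.eval_var, if_pos rfl, unitX]

theorem specialize_var_of_ne {c : (encircledLink o).Component} (hc : c ≠ circle o) :
    specialize o (MvLaurent.var c : MvLaurent (encircledLink o).Component) = -1 := by
  rw [specialize, MvLaurent.eval_var, if_neg hc, Units.val_neg, Units.val_one]

theorem specialize_meridian_front (j : Fin (2 * P.k + 1)) :
    specialize o ((encircledLink o).meridian (.front j)) = unitX := by
  rw [LinkDiagram.meridian, component_front, specialize_var_circle]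

theorem specialize_meridian_back (j : Fin (2 * P.k + 1)) :
    specialize o ((encircledLink o).meridian (.back j)) = unitX := by
  rw [LinkDiagram.meridian, component_back, specialize_var_circle]

theorem specialize_meridian_strand (d : E × Bool) (j : Fin 5) :
    specialize o ((encircledLink o).meridian (.strand d j)) = -1 := by
  rw [LinkDiagram.meridian, component_strand,
    specialize_var_of_ne o (strandComponent_ne_circle o d)]

/-- The relation at a crossing between the colors of the segments, when the meridian of the circle
acts as `x`, the meridians of the medial link act as `-1`, and the front of the circle has
color zero. -/
def CrossingRelation {A W : Type*} [CommRing A] [AddCommGroup W] [Module A W] (x : Aˣ)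
    (α : P.Segment → W) : P.Crossing → Prop
  | .edge e => α (underSegment o (.edge e)) + α (nextSegment o (underSegment o (.edge e))) =
      (2 : A) • α (overSegment o (.edge e))
  | .firstFront i => α (.strand (P.cut i) 2) = x • α (.strand (P.cut i) 1)
  | .secondFront i =>
      α (.strand (P.rot.symm (P.cut i)) 2) = x • α (.strand (P.rot.symm (P.cut i)) 3)
  | .firstBack i => α (.back ⟨2 * i, by lia⟩) + α (.back ⟨2 * i + 1, by lia⟩) =
      (1 - (x : A)) • α (overSegment o (.firstBack i))
  | .secondBack i => α (.back ⟨2 * i + 1, by lia⟩) + α (.back ⟨2 * i + 2, by lia⟩) =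
      (1 - (x : A)) • α (overSegment o (.secondBack i))

theorem isSolution_map_specialize_iff {W : Type*} [AddCommGroup W] [Module ℤ[T;T⁻¹] W]
    [Fintype (encircledLink o).Arc] {a : (encircledLink o).Arc → W}
    (ha : ∀ j, a ((encircledLink o).arc (.front j)) = 0) :
    IsSolution ((encircledLink o).alexanderMatrix.map (specialize o)) a ↔
      ∀ c, CrossingRelation o unitX (fun s => a ((encircledLink o).arc s)) c := by
  rw [LinkDiagram.isSolution_map_alexanderMatrix_iff]
  refine forall_congr' fun c => ?_
  have hstrand := (encircledLink o).relation_iff_of_meridian_overIn_eq_neg_one (specialize o) a c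
  rw [encircledLink_underIn, encircledLink_overIn, encircledLink_next] at *
  rcases c with e | i | i | i | i
  · obtain ⟨d₁, d₂, -, -, -, hfirst, hsecond, -⟩ := exists_strands o e
    have hover : specialize o ((encircledLink o).meridian (overSegment o (.edge e))) = -1 := by
      simp only [overSegment, hfirst, hsecond]
      split_ifs <;> exact specialize_meridian_strand o _ _
    have hunder : specialize o ((encircledLink o).meridian (underSegment o (.edge e))) = -1 := by
      simp only [underSegment, hfirst, hsecond]
      split_ifs <;> exact specialize_meridian_strand o _ _
    rw [hstrand hover, hunder, sub_neg_eq_add, one_add_one_eq_two]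
    rfl
  · simp only [overSegment, ha, smul_zero, add_zero, underRight_firstFront, underLeft_firstFront,
      specialize_meridian_front]
    rfl
  · rw [hstrand (specialize_meridian_strand o _ _), nextSegment_underSegment_firstBack, add_comm]
    simp only [underSegment, specialize_meridian_back]
    rfl
  · simp only [overSegment, ha, smul_zero, add_zero, underRight_secondFront,
      underLeft_secondFront, specialize_meridian_front]
    rfl
  · rw [hstrand (specialize_meridian_strand o _ _), nextSegment_underSegment_secondBack, add_comm]
    simp only [underSegment, specialize_meridian_back]
    rfl

section Colorings

variable {A W : Type*} [CommRing A] [AddCommGroup W] [Module A W] (x : Aˣ)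

/-- Colorings of the segments that are constant on arcs, satisfy all crossing relations and vanish
on the front of the circle, in terms of the geometry of the graph: no orientation of the medial
link enters. The colors `strand d 0` and `strand (rot⁻¹ d) 4` belong to the two strands that meet at
the crossing of the edge of `d`; the former passes over at the positive edges. -/
structure IsColoring (P : AnnularEmbedding G R) (α : P.Segment → W) : Prop where
  front : ∀ j, α (.front j) = 0
  back_zero : α (.back 0) = 0
  back_last : α (.back (Fin.last _)) = 0
  strand_one : ∀ d, α (.strand d 1) = α (.strand d 0)
  strand_three : ∀ d, α (.strand d 3) = α (.strand d 4)
  strand_two : ∀ d, α (.strand d 2) = P.twist x d • α (.strand d 1)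
  strand_two' : ∀ d, α (.strand d 2) = P.twist x (P.rot d) • α (.strand d 3)
  first_back : ∀ i : Fin P.k, α (.back ⟨2 * i, by lia⟩) + α (.back ⟨2 * i + 1, by lia⟩) =
    (1 - (x : A)) • α (.strand (P.cut i) 0)
  second_back : ∀ i : Fin P.k,
    α (.back ⟨2 * i + 1, by lia⟩) + α (.back ⟨2 * i + 2, by lia⟩) =
      (1 - (x : A)) • α (.strand (P.rot.symm (P.cut i)) 4)
  edge_pos : ∀ d, G.sign d.1 = 1 → α (.strand (Dart.rev d) 0) = α (.strand d 0)
  edge_neg : ∀ d, G.sign d.1 ≠ 1 →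
    α (.strand (P.rot.symm (Dart.rev d)) 4) = α (.strand (P.rot.symm d) 4)
  edge_sum : ∀ d, α (.strand d 0) + α (.strand (Dart.rev d) 0) =
    α (.strand (P.rot.symm d) 4) + α (.strand (P.rot.symm (Dart.rev d)) 4)

theorem crossingRelation_edge_iff {α : P.Segment → W}
    (hpos : ∀ d, G.sign d.1 = 1 → α (.strand (Dart.rev d) 0) = α (.strand d 0))
    (hneg : ∀ d, G.sign d.1 ≠ 1 →
      α (.strand (P.rot.symm (Dart.rev d)) 4) = α (.strand (P.rot.symm d) 4)) (d : E × Bool) :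
    CrossingRelation o x α (.edge d.1) ↔
      α (.strand d 0) + α (.strand (Dart.rev d) 0) =
        α (.strand (P.rot.symm d) 4) + α (.strand (P.rot.symm (Dart.rev d)) 4) := by
  obtain ⟨d₁, d₂, hedge, hdir₁, hdir₂, hfirst, hsecond, hrot⟩ := exists_strands o d.1
  have hd₁ : d = d₁ ∨ d = Dart.rev d₁ := by
    rcases d with ⟨e, _ | _⟩ <;> rcases d₁ with ⟨e', _ | _⟩ <;> simp_all [Dart.rev]
  have hd₂ : d = P.rot d₂ ∨ d = Dart.rev (P.rot d₂) := by
    rcases hrot with ⟨hrot, -⟩ | ⟨hrot, -⟩ <;> rw [hrot]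
    · exact hd₁
    · rw [Dart.rev_rev]; exact hd₁.symm
  have hsum₁ : α (.strand d 0) + α (.strand (Dart.rev d) 0) =
      α (.strand d₁ 0) + α (.strand (Dart.rev d₁) 0) := by
    rcases hd₁ with rfl | rfl
    · rfl
    · rw [Dart.rev_rev, add_comm]
  have hsum₂ : α (.strand (P.rot.symm d) 4) + α (.strand (P.rot.symm (Dart.rev d)) 4) =
      α (.strand d₂ 4) + α (.strand (P.rot.symm (Dart.rev (P.rot d₂))) 4) := by
    rcases hd₂ with rfl | rfl
    · rw [Equiv.symm_apply_apply]
    · rw [Dart.rev_rev, Equiv.symm_apply_apply, add_comm]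
  rw [hsum₁, hsum₂]
  simp only [CrossingRelation, overSegment, underSegment, hfirst, hsecond]
  by_cases hs : G.sign d.1 = 1
  · simp only [hs, if_true, (next_strand_of_dir hdir₂).2.2.2.2]
    rw [hpos d₁ (hedge ▸ hs), two_smul, eq_comm]
  · have hs₂ : G.sign (P.rot d₂).1 ≠ 1 := by
      rcases hd₂ with rfl | rfl <;> exact hs
    have hneg₂ := hneg _ hs₂
    rw [Equiv.symm_apply_apply] at hneg₂
    simp only [hs, if_false, (next_strand_of_not_dir hdir₁).2.2.2.2]
    rw [hneg₂, two_smul]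

variable {o x} {α : P.Segment → W}

theorem isColoring_of_isConstantOnArcs (hα : (encircledLink o).IsConstantOnArcs α)
    (h0 : α (.front 0) = 0) (hc : ∀ c, CrossingRelation o x α c) : IsColoring x P α where
  front j := (hα.apply_front j).trans h0
  back_zero := hα.apply_back_zero.trans h0
  back_last := hα.apply_back_last.trans h0
  strand_one := hα.apply_strand_one
  strand_three := hα.apply_strand_three
  strand_two d := by
    by_cases hd : d ∈ Set.range P.cut
    · obtain ⟨i, rfl⟩ := hd
      rw [twist_cut]
      exact hc (.firstFront i)
    · rw [P.twist_of_notMem x hd, one_smul, hα.apply_strand_two_of_notMem hd]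
  strand_two' d := by
    by_cases hd : P.rot d ∈ Set.range P.cut
    · obtain ⟨i, hi⟩ := hd
      obtain rfl : d = P.rot.symm (P.cut i) := by rw [hi, Equiv.symm_apply_apply]
      rw [Equiv.apply_symm_apply, twist_cut]
      exact hc (.secondFront i)
    · rw [P.twist_of_notMem x hd, one_smul, hα.apply_strand_two_of_rot_notMem hd]
  first_back i := by
    rw [hc (.firstBack i)]
    simp only [overSegment]
    split_ifs <;> simp only [hα.apply_strand_one]
  second_back i := by
    rw [hc (.secondBack i)]
    simp only [overSegment]
    split_ifs <;> simp only [hα.apply_strand_three]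
  edge_pos _ hs := hα.apply_strand_rev hs
  edge_neg _ hs := hα.apply_strand_rot_symm_rev hs
  edge_sum d := (crossingRelation_edge_iff o x (fun _ => hα.apply_strand_rev)
    (fun _ => hα.apply_strand_rot_symm_rev) d).1 (hc _)

namespace IsColoring

variable (h : IsColoring x P α)
include h

theorem crossingRelation (c : P.Crossing) : CrossingRelation o x α c := by
  rcases c with e | i | i | i | i
  · exact (crossingRelation_edge_iff o x h.edge_pos h.edge_neg (e, true)).2 (h.edge_sum _)
  · exact (h.strand_two _).trans (by rw [twist_cut])
  · simp only [CrossingRelation, overSegment]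
    rw [h.first_back]
    split_ifs <;> simp only [h.strand_one]
  · have htwo := h.strand_two' (P.rot.symm (P.cut i))
    rwa [Equiv.apply_symm_apply, twist_cut] at htwo
  · simp only [CrossingRelation, overSegment]
    rw [h.second_back]
    split_ifs <;> simp only [h.strand_three]

theorem strand_two_of_notMem {d : E × Bool} (hd : d ∉ Set.range P.cut) :
    α (.strand d 2) = α (.strand d 1) := by
  rw [h.strand_two, P.twist_of_notMem x hd, one_smul]

theorem strand_two_of_rot_notMem {d : E × Bool} (hd : P.rot d ∉ Set.range P.cut) :
    α (.strand d 2) = α (.strand d 3) := by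
  rw [h.strand_two', P.twist_of_notMem x hd, one_smul]

theorem apply_nextSegment_strand_of_not_dir {d : E × Bool} (hd : o.dir d = false) {j : Fin 5}
    (hs : (.strand d j : P.Segment) ∉ Set.range (underSegment o)) :
    α (nextSegment o (.strand d j)) = α (.strand d j) := by
  rw [strand_mem_range_underSegment_iff, hd] at hs
  obtain ⟨hnext₄, hnext₃, hnext₂, hnext₁, hnext₀⟩ := next_strand_of_not_dir hd
  fin_cases j
  · exact (congrArg α hnext₀).trans (h.edge_pos d (by_contra fun hn => hs (by simp [hn])))
  · exact (congrArg α hnext₁).trans (h.strand_one d).symm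
  · exact (congrArg α hnext₂).trans
      (h.strand_two_of_notMem fun hn => hs (.inl ⟨hn, rfl⟩)).symm
  · exact (congrArg α hnext₃).trans
      (h.strand_two_of_rot_notMem fun hn => hs (.inr (.inl ⟨hn, rfl⟩)))
  · exact (congrArg α hnext₄).trans (h.strand_three d)

theorem apply_nextSegment_strand_of_dir {d : E × Bool} (hd : o.dir d = true) {j : Fin 5}
    (hs : (.strand d j : P.Segment) ∉ Set.range (underSegment o)) :
    α (nextSegment o (.strand d j)) = α (.strand d j) := by
  rw [strand_mem_range_underSegment_iff, hd] at hs
  obtain ⟨hnext₀, hnext₁, hnext₂, hnext₃, hnext₄⟩ := next_strand_of_dir hd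
  have hneg := h.edge_neg (P.rot d)
  rw [Equiv.symm_apply_apply] at hneg
  fin_cases j
  · exact (congrArg α hnext₀).trans (h.strand_one d)
  · exact (congrArg α hnext₁).trans (h.strand_two_of_notMem fun hn => hs (.inl ⟨hn, rfl⟩))
  · exact (congrArg α hnext₂).trans
      (h.strand_two_of_rot_notMem fun hn => hs (.inr (.inl ⟨hn, rfl⟩))).symm
  · exact (congrArg α hnext₃).trans (h.strand_three d).symm
  · exact (congrArg α hnext₄).trans (hneg fun hn => hs (by simp [hn]))

theorem isConstantOnArcs : (encircledLink o).IsConstantOnArcs α := by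
  rw [LinkDiagram.IsConstantOnArcs, encircledLink_underIn, encircledLink_next]
  rintro (⟨d, j⟩ | ⟨j, hj⟩ | j) hs
  · cases hd : o.dir d
    · exact h.apply_nextSegment_strand_of_not_dir hd hs
    · exact h.apply_nextSegment_strand_of_dir hd hs
  · rw [h.front, nextSegment]
    split_ifs with hlt
    · exact h.front _
    · obtain rfl : j = 2 * P.k := by simp only at hlt; lia
      exact h.back_last
  · obtain rfl : j = 0 := by rwa [back_mem_range_underSegment_iff, not_not] at hs
    rw [h.back_zero]
    simp [nextSegment, h.front]

end IsColoring

variable [Module ℤ[T;T⁻¹] W] [Fintype (encircledLink o).Arc]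

theorem isColoring_of_isSolution {a : (encircledLink o).Arc → W}
    (h : IsSolution ((encircledLink o).alexanderMatrix.map (specialize o)) a)
    (h0 : a ((encircledLink o).arc (.front 0)) = 0) :
    IsColoring unitX P fun s => a ((encircledLink o).arc s) := by
  have harc := (encircledLink o).isConstantOnArcs_comp_arc a
  exact isColoring_of_isConstantOnArcs harc h0
    ((isSolution_map_specialize_iff o fun j => (harc.apply_front j).trans h0).1 h)

theorem IsColoring.exists_isSolution (h : IsColoring unitX P α) :
    ∃ a : (encircledLink o).Arc → W, (∀ s, a ((encircledLink o).arc s) = α s) ∧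
      IsSolution ((encircledLink o).alexanderMatrix.map (specialize o)) a := by
  obtain ⟨a, ha⟩ := (h.isConstantOnArcs (o := o)).exists_apply_arc
  refine ⟨a, ha, (isSolution_map_specialize_iff o fun j => (ha _).trans (h.front j)).2 ?_⟩
  simpa only [ha] using h.crossingRelation

end Colorings

end AnnularEmbedding

namespace AnnularEmbedding

variable {V E R : Type*} [Fintype V] [Fintype E] [Fintype R] {G : PeriodicGraph V E}
  {A W : Type*} [CommRing A] [AddCommGroup W] [Module A W] {x : Aˣ}

section

variable (P : AnnularEmbedding G R)

/-- The difference between the two values that a twisted function `m` on the corners takes along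
the directed edge `d`: in the corner `d` at its initial vertex and in the corner `face d` at its
terminal vertex, both in the region on the left. -/
def alongDiff (x : Aˣ) (m : E × Bool → W) (d : E × Bool) : W :=
  (P.twist x d)⁻¹ • m d - (P.twist x (Dart.rev d))⁻¹ • m (P.face d)

/-- The difference between the values that a twisted function `m` on the corners takes in the two
corners at the initial vertex of `d` on either side of `d`. -/
def acrossDiff (x : Aˣ) (m : E × Bool → W) (d : E × Bool) : W :=
  (P.twist x d)⁻¹ • (m d - m (P.rot.symm d))

/-- The vertex function `w` is in the kernel of the twisted Laplacian. -/
def IsHarmonic (x : Aˣ) (w : V → W) : Prop :=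
  ∀ v, open Classical in ∑ d with G.start d = v,
    (G.sign d.1 : ℤ) • P.twist x d • P.alongDiff x (w ∘ G.start) d = 0

/-- The function `m` on the corners gives the colors of the middle segments of the strands in a
coloring. -/
structure IsCornerColoring (x : Aˣ) (m : E × Bool → W) : Prop where
  acrossDiff_rev (d : E × Bool) : P.acrossDiff x m (Dart.rev d) = -P.acrossDiff x m d
  acrossDiff_eq (d : E × Bool) :
    P.acrossDiff x m d = -((G.sign d.1 : ℤ) • P.alongDiff x m d)

end

variable {P : AnnularEmbedding G R}

theorem alongDiff_add (m ρ : E × Bool → W) (d : E × Bool) :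
    P.alongDiff x (m + ρ) d = P.alongDiff x m d + P.alongDiff x ρ d := by
  simp only [alongDiff, Pi.add_apply, smul_add]
  abel

theorem alongDiff_comp_start_rev (w : V → W) (d : E × Bool) :
    P.alongDiff x (w ∘ G.start) (Dart.rev d) = -P.alongDiff x (w ∘ G.start) d := by
  simp only [alongDiff, Function.comp_apply, face_apply, Dart.rev_rev, start_rot_symm, neg_sub]

theorem alongDiff_mem_span (m : E × Bool → W) (d : E × Bool) :
    P.alongDiff x m d ∈ Submodule.span A (Set.range m) :=
  Submodule.sub_mem _
    (Submodule.smul_mem _ (((P.twist x d)⁻¹ : Aˣ) : A) (Submodule.subset_span ⟨_, rfl⟩))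
    (Submodule.smul_mem _ (((P.twist x (Dart.rev d))⁻¹ : Aˣ) : A) (Submodule.subset_span ⟨_, rfl⟩))

theorem acrossDiff_mem_span (m : E × Bool → W) (d : E × Bool) :
    P.acrossDiff x m d ∈ Submodule.span A (Set.range m) :=
  Submodule.smul_mem _ (((P.twist x d)⁻¹ : Aˣ) : A)
    (Submodule.sub_mem _ (Submodule.subset_span ⟨_, rfl⟩) (Submodule.subset_span ⟨_, rfl⟩))

theorem IsCornerColoring.isTwistedFlow {m : E × Bool → W} (h : P.IsCornerColoring x m) :
    P.IsTwistedFlow x m (P.acrossDiff x m) where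
  rev := h.acrossDiff_rev
  sub_eq _ := (smul_inv_smul _ _).symm

section OfColoring

variable {α : P.Segment → W}

theorem IsColoring.strand_zero (h : IsColoring x P α) (d : E × Bool) :
    α (.strand d 0) = (P.twist x d)⁻¹ • α (.strand d 2) := by
  rw [h.strand_two, inv_smul_smul, h.strand_one]

theorem IsColoring.strand_four (h : IsColoring x P α) (d : E × Bool) :
    α (.strand (P.rot.symm d) 4) = (P.twist x d)⁻¹ • α (.strand (P.rot.symm d) 2) := by
  rw [h.strand_two', Equiv.apply_symm_apply, inv_smul_smul, h.strand_three]

theorem IsColoring.acrossDiff_eq (h : IsColoring x P α) (d : E × Bool) :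
    P.acrossDiff x (fun d => α (.strand d 2)) d =
      α (.strand d 0) - α (.strand (P.rot.symm d) 4) := by
  rw [h.strand_zero, h.strand_four, acrossDiff, smul_sub]

theorem IsColoring.alongDiff_eq (h : IsColoring x P α) (d : E × Bool) :
    P.alongDiff x (fun d => α (.strand d 2)) d =
      α (.strand d 0) - α (.strand (P.rot.symm (Dart.rev d)) 4) := by
  rw [h.strand_zero, h.strand_four, alongDiff, face_apply]

theorem IsColoring.isCornerColoring (h : IsColoring x P α) :
    P.IsCornerColoring x fun d => α (.strand d 2) where
  acrossDiff_rev d := by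
    rw [h.acrossDiff_eq, h.acrossDiff_eq]
    linear_combination (norm := abel) h.edge_sum d
  acrossDiff_eq d := by
    rw [h.acrossDiff_eq, h.alongDiff_eq]
    rcases Int.units_eq_one_or (G.sign d.1) with hs | hs
    · rw [hs, Units.val_one, one_smul]
      linear_combination (norm := abel) h.edge_sum d - h.edge_pos d hs
    · rw [h.edge_neg d (by rw [hs]; decide), hs, Units.val_neg, Units.val_one, neg_smul, one_smul,
        neg_neg]

theorem IsColoring.back_mem (h : IsColoring x P α) {S : Submodule A W}
    (hS : ∀ d, α (.strand d 0) ∈ S ∧ α (.strand d 4) ∈ S) (j : ℕ) (hj : j < 2 * P.k + 1) :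
    α (.back ⟨j, hj⟩) ∈ S := by
  induction j with
  | zero => exact h.back_zero ▸ S.zero_mem
  | succ j ih =>
    rcases Nat.even_or_odd' j with ⟨i, rfl | rfl⟩
    · have hback := h.first_back ⟨i, by lia⟩
      rw [← eq_sub_iff_add_eq'] at hback
      exact hback ▸ S.sub_mem (S.smul_mem _ (hS _).1) (ih _)
    · have hback := h.second_back ⟨i, by lia⟩
      rw [← eq_sub_iff_add_eq'] at hback
      exact hback ▸ S.sub_mem (S.smul_mem _ (hS _).2) (ih _)

theorem IsColoring.mem_span (h : IsColoring x P α) (s : P.Segment) :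
    α s ∈ Submodule.span A (Set.range fun d => α (.strand d 2)) := by
  set S := Submodule.span A (Set.range fun d => α (.strand d 2))
  have htwo : ∀ d, α (.strand d 2) ∈ S := fun d => Submodule.subset_span ⟨d, rfl⟩
  have hzero : ∀ d, α (.strand d 0) ∈ S := fun d =>
    h.strand_zero d ▸ S.smul_mem (((P.twist x d)⁻¹ : Aˣ) : A) (htwo d)
  have hfour : ∀ d, α (.strand d 4) ∈ S := fun d => by
    rw [← P.rot.symm_apply_apply d, h.strand_four]
    exact S.smul_mem (((P.twist x (P.rot d))⁻¹ : Aˣ) : A) (htwo _)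
  rcases s with ⟨d, j⟩ | j | ⟨j, hj⟩
  · fin_cases j
    · exact hzero d
    · exact h.strand_one d ▸ hzero d
    · exact htwo d
    · exact h.strand_three d ▸ hfour d
    · exact hfour d
  · exact h.front j ▸ S.zero_mem
  · exact h.back_mem (fun d => ⟨hzero d, hfour d⟩) j hj

end OfColoring

section ToColoring

variable (P) in
/-- The coloring of all segments that extends a coloring `m` of the corners. The colors of the back
parallel of `γ` are forced by the relations at the crossings that it meets, starting from `0`. -/
def colorExtension (x : Aˣ) (m : E × Bool → W) : P.Segment → W
  | .strand d j =>
    if (j : ℕ) < 2 then (P.twist x d)⁻¹ • m d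
    else if (j : ℕ) = 2 then m d
    else (P.twist x (P.rot d))⁻¹ • m d
  | .front _ => 0
  | .back j =>
    if h : (j : ℕ) % 2 = 1 then
      (1 - (x : A)) • x⁻¹ • m (P.cut ⟨j / 2, by lia⟩) -
        ((x : A) - 1) • P.flux (P.acrossDiff x m) ⟨j / 2, by lia⟩
    else ((x : A) - 1) • P.flux (P.acrossDiff x m) ⟨j / 2, by lia⟩

variable {m : E × Bool → W}

theorem colorExtension_back_two_mul (i : ℕ) (hi : 2 * i < 2 * P.k + 1) :
    P.colorExtension x m (.back ⟨2 * i, hi⟩) =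
      ((x : A) - 1) • P.flux (P.acrossDiff x m) ⟨i, by lia⟩ := by
  have hdiv : 2 * i / 2 = i := by lia
  simp only [colorExtension, hdiv]
  rw [dif_neg (by lia)]

theorem colorExtension_back_two_mul_add_one (i : Fin P.k) :
    P.colorExtension x m (.back ⟨2 * i + 1, by lia⟩) =
      (1 - (x : A)) • x⁻¹ • m (P.cut i) -
        ((x : A) - 1) • P.flux (P.acrossDiff x m) i.castSucc := by
  have hdiv : (2 * (i : ℕ) + 1) / 2 = i := by lia
  simp only [colorExtension, hdiv]
  rw [dif_pos (by lia)]
  rfl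

theorem colorExtension_strand_zero (d : E × Bool) :
    P.colorExtension x m (.strand d 0) = (P.twist x d)⁻¹ • m d := rfl

theorem colorExtension_strand_four (d : E × Bool) :
    P.colorExtension x m (.strand (P.rot.symm d) 4) = (P.twist x d)⁻¹ • m (P.rot.symm d) := by
  change (P.twist x (P.rot (P.rot.symm d)))⁻¹ • m (P.rot.symm d) = _
  rw [Equiv.apply_symm_apply]

theorem IsCornerColoring.isColoring_colorExtension (h : P.IsCornerColoring x m) :
    IsColoring x P (P.colorExtension x m) where
  front _ := rfl
  back_zero := (colorExtension_back_two_mul 0 _).trans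
    ((congrArg _ (P.flux_zero _)).trans (smul_zero _))
  back_last := (colorExtension_back_two_mul P.k _).trans h.isTwistedFlow.smul_flux_last
  strand_one _ := rfl
  strand_three _ := rfl
  strand_two _ := (smul_inv_smul _ _).symm
  strand_two' _ := (smul_inv_smul _ _).symm
  first_back i := by
    rw [colorExtension_back_two_mul, colorExtension_back_two_mul_add_one,
      colorExtension_strand_zero, twist_cut]
    exact add_sub_cancel _ _
  second_back i := by
    have hflux := P.flux_succ (P.acrossDiff x m) i
    rw [acrossDiff, twist_cut] at hflux
    refine (congrArg _ (colorExtension_back_two_mul (i + 1) _)).trans ?_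
    rw [colorExtension_back_two_mul_add_one, colorExtension_strand_four, twist_cut]
    refine (congrArg _ (congrArg _ hflux)).trans ?_
    simp only [Units.smul_def]
    module
  edge_pos d hd := by
    have hrev := h.acrossDiff_rev d
    have heq := h.acrossDiff_eq d
    rw [hd, Units.val_one, one_smul] at heq
    simp only [acrossDiff, alongDiff, face_apply, smul_sub] at hrev heq
    simp only [colorExtension_strand_zero]
    linear_combination (norm := abel) hrev - heq
  edge_neg d hd := by
    have heq := h.acrossDiff_eq d
    rw [(Int.units_eq_one_or _).resolve_left hd, Units.val_neg, Units.val_one, neg_smul, one_smul,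
      neg_neg, acrossDiff, alongDiff, smul_sub, sub_right_inj, face_apply] at heq
    rw [colorExtension_strand_four, colorExtension_strand_four, heq]
  edge_sum d := by
    have hrev := h.acrossDiff_rev d
    simp only [acrossDiff, smul_sub] at hrev
    simp only [colorExtension_strand_zero, colorExtension_strand_four]
    linear_combination (norm := abel) hrev

end ToColoring

theorem apply_mem_of_sub_rot_mem {S : Submodule A W} {u : R → W} (hu : u (P.path 0) = 0)
    (h : ∀ d, u (P.left (P.rot d)) - u (P.left d) ∈ S) (r : R) : u r ∈ S := by
  have hrot : ∀ d, (u (P.left (P.rot d)) ∈ S) = (u (P.left d) ∈ S) := fun d =>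
    propext ⟨fun hd => (S.sub_mem_iff_right hd).1 (h d), fun hd => (S.sub_mem_iff_left hd).1 (h d)⟩
  refine P.induction_of_connected (x₀ := .inr (P.path 0))
    (p := Sum.elim (fun v => ∀ d, G.start d = v → u (P.left d) ∈ S) fun r => u r ∈ S)
    (by simp [hu]) (fun d => ⟨fun hd => hd d rfl, fun hd d' hd' => ?_⟩) (.inr r)
  exact (P.apply_eq_of_rot (y := fun d => u (P.left d) ∈ S) hrot hd').mpr hd

theorem apply_mem_of_add_mem {S : Submodule A W} {w : V → W} {u : R → W} (hu : u (P.path 0) = 0)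
    (h : ∀ d, w (G.start d) + u (P.left d) ∈ S) (v : V) : w v ∈ S :=
  P.induction_of_connected (x₀ := .inr (P.path 0))
    (p := Sum.elim (fun v => w v ∈ S) fun r => u r ∈ S) (by simp [hu])
    (fun d => ⟨fun hd => (S.add_mem_iff_right hd).1 (h d),
      fun hd => (S.add_mem_iff_left hd).1 (h d)⟩) (.inl v)

theorem alongDiff_eq_alongDiff_comp_start {m ρ : E × Bool → W} {w : V → W}
    (hm : ∀ d, m d = w (G.start d) + ρ d)
    (hρ : ∀ d, (P.twist x d)⁻¹ • ρ d = (P.twist x (Dart.rev d))⁻¹ • ρ (P.face d)) (d : E × Bool) :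
    P.alongDiff x m d = P.alongDiff x (w ∘ G.start) d := by
  obtain rfl : m = w ∘ G.start + ρ := funext hm
  rw [alongDiff_add, add_eq_left, alongDiff, hρ, sub_self]

theorem IsCornerColoring.isHarmonic {m : E × Bool → W} (h : P.IsCornerColoring x m) {w : V → W}
    (hw : ∀ d, P.alongDiff x m d = P.alongDiff x (w ∘ G.start) d) : P.IsHarmonic x w := fun v => by
  classical
  rw [← neg_eq_zero, ← P.sum_sub_rot_symm_eq_zero m id v, ← Finset.sum_neg_distrib]
  refine Finset.sum_congr (by simp) fun d _ => ?_
  rw [h.isTwistedFlow.sub_eq, h.acrossDiff_eq, hw, smul_neg, smul_comm]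

theorem IsCornerColoring.exists_isHarmonic {m : E × Bool → W} (h : P.IsCornerColoring x m) :
    ∃ w : V → W, P.IsHarmonic x w ∧ ∀ d, m d ∈ Submodule.span A (Set.range w) := by
  obtain ⟨w, ρ, u, hu, hm, hρ, hspan⟩ := h.isTwistedFlow.exists_potential
  have halong := alongDiff_eq_alongDiff_comp_start hm hρ
  refine ⟨w, h.isHarmonic halong, ?_⟩
  set S := Submodule.span A (Set.range w)
  have hw : ∀ v, w v ∈ S := fun v => Submodule.subset_span ⟨v, rfl⟩
  have hacross : ∀ d, P.acrossDiff x m d ∈ S := fun d => by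
    rw [h.acrossDiff_eq, halong]
    exact S.neg_mem (S.smul_of_tower_mem _
      (Submodule.span_mono (Set.range_comp_subset_range _ _) (alongDiff_mem_span _ d)))
  have hρu : ∀ d, ρ d - u (P.left d) ∈ S := fun d =>
    Submodule.span_le.2 (Set.range_subset_iff.2 hacross) (hspan d)
  have hu : ∀ r, u r ∈ S := apply_mem_of_sub_rot_mem hu fun d => by
    have hjump := h.isTwistedFlow.sub_eq (P.rot d)
    rw [hm, hm, Equiv.symm_apply_apply, P.start_rot, add_sub_add_left_eq_sub] at hjump
    have hsmul : P.twist x (P.rot d) • P.acrossDiff x m (P.rot d) ∈ S :=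
      S.smul_mem (P.twist x (P.rot d) : A) (hacross _)
    rw [← hjump] at hsmul
    convert S.sub_mem hsmul (S.sub_mem (hρu (P.rot d)) (hρu d)) using 1
    abel
  intro d
  rw [hm, ← sub_add_cancel (ρ d) (u (P.left d))]
  exact S.add_mem (hw _) (S.add_mem (hρu d) (hu _))

theorem IsHarmonic.exists_isTwistedFlow {w : V → W} (h : P.IsHarmonic x w) :
    ∃ m, P.IsTwistedFlow x m
      fun d => -((G.sign d.1 : ℤ) • P.alongDiff x (w ∘ G.start) d) := by
  classical
  obtain ⟨m, hm⟩ := exists_sub_eq_of_sum_eq_zero P.rot G.start P.sameCycle_rot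
    (fun d => P.twist x d • -((G.sign d.1 : ℤ) • P.alongDiff x (w ∘ G.start) d)) fun v => by
      rw [← Finset.sum_filter, ← neg_eq_zero, ← h v, ← Finset.sum_neg_distrib]
      refine Finset.sum_congr (by simp) fun d _ => ?_
      rw [smul_neg, neg_neg, smul_comm]
  refine ⟨m, fun d => ?_, hm⟩
  rw [alongDiff_comp_start_rev, smul_neg]
  rfl

theorem IsHarmonic.exists_isCornerColoring {w : V → W} (h : P.IsHarmonic x w) :
    ∃ m, P.IsCornerColoring x m ∧ ∀ v, w v ∈ Submodule.span A (Set.range m) := by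
  obtain ⟨m₀, hflow⟩ := h.exists_isTwistedFlow
  obtain ⟨w₀, ρ, u, hu, hm₀, hρ, hspan⟩ := hflow.exists_potential
  set m : E × Bool → W := w ∘ G.start + ρ
  have halong : ∀ d, P.alongDiff x m d = P.alongDiff x (w ∘ G.start) d :=
    alongDiff_eq_alongDiff_comp_start (fun _ => rfl) hρ
  have hacross : ∀ d, P.acrossDiff x m d =
      -((G.sign d.1 : ℤ) • P.alongDiff x (w ∘ G.start) d) := fun d => by
    have hjump := hflow.sub_eq d
    rw [hm₀, hm₀, start_rot_symm, add_sub_add_left_eq_sub] at hjump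
    rw [acrossDiff, inv_smul_eq_iff, ← hjump]
    simp only [m, Pi.add_apply, Function.comp_apply, start_rot_symm, add_sub_add_left_eq_sub]
  refine ⟨m, ⟨fun d => ?_, fun d => ?_⟩, apply_mem_of_add_mem hu fun d => ?_⟩
  · rw [hacross, hacross]
    exact hflow.rev d
  · rw [hacross, halong]
  · rw [← funext hacross] at hspan
    have hρu : ρ d - u (P.left d) ∈ Submodule.span A (Set.range m) :=
      Submodule.span_le.2 (Set.range_subset_iff.2 (acrossDiff_mem_span m)) (hspan d)
    have hmd : m d ∈ Submodule.span A (Set.range m) := Submodule.subset_span ⟨d, rfl⟩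
    convert Submodule.sub_mem _ hmd hρu using 1
    simp only [m, Pi.add_apply, Function.comp_apply]
    abel

theorem IsColoring.exists_isHarmonic {α : P.Segment → W} (h : IsColoring x P α) :
    ∃ w : V → W, P.IsHarmonic x w ∧ ∀ s, α s ∈ Submodule.span A (Set.range w) := by
  obtain ⟨w, hw, hm⟩ := h.isCornerColoring.exists_isHarmonic
  exact ⟨w, hw, fun s => Submodule.span_le.2 (Set.range_subset_iff.2 hm) (h.mem_span s)⟩

theorem IsHarmonic.exists_isColoring {w : V → W} (h : P.IsHarmonic x w) :
    ∃ α : P.Segment → W, IsColoring x P α ∧ ∀ v, w v ∈ Submodule.span A (Set.range α) := by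
  obtain ⟨m, hm, hw⟩ := h.exists_isCornerColoring
  refine ⟨_, hm.isColoring_colorExtension, fun v => Submodule.span_mono ?_ (hw v)⟩
  exact Set.range_subset_iff.2 fun d => ⟨.strand d 2, rfl⟩

end AnnularEmbedding

/-! ### The Laplacian and the Alexander matrix -/

theorem isSolution_submatrix_subtypeVal_iff {k n A W : Type*} [Fintype n] [CommRing A]
    [AddCommGroup W] [Module A W] [DecidableEq n] {j : n} (N : Matrix k n A) {w : n → W}
    (hw : w j = 0) :
    IsSolution (N.submatrix id Subtype.val) (fun b : {a // a ≠ j} => w b) ↔ IsSolution N w := by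
  refine forall_congr' fun i => ?_
  rw [Fintype.sum_eq_add_sum_subtype_ne _ j, hw, smul_zero, zero_add]
  rfl

namespace PeriodicGraph

variable {V E W : Type*} [Fintype E] [AddCommGroup W] [Module ℤ[T;T⁻¹] W]

theorem laurentPolynomial_C_smul (s : ℤ) (y : W) :
    (LaurentPolynomial.C s : ℤ[T;T⁻¹]) • y = s • y := by
  rw [← Int.cast_smul_eq_zsmul ℤ[T;T⁻¹] s y]
  exact congrArg (· • y) (map_intCast (LaurentPolynomial.C : ℤ →+* ℤ[T;T⁻¹]) s)

variable [Fintype V] (G : PeriodicGraph V E) (y : V → W) (i : V)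

open Classical in
theorem sum_degreeMatrix_smul :
    ∑ j, G.degreeMatrix i j • y j = ∑ d with G.start d = i, (G.sign d.1 : ℤ) • y i := by
  rw [Fintype.sum_eq_single i fun j hj => by
    rw [degreeMatrix, Matrix.diagonal_apply_ne _ hj.symm, zero_smul]]
  simp only [degreeMatrix, Matrix.diagonal_apply_eq, Finset.sum_smul, ite_smul,
    laurentPolynomial_C_smul, zero_smul, Finset.sum_filter]

open Classical in
theorem sum_adjacencyMatrix_smul :
    ∑ j, G.adjacencyMatrix i j • y j = ∑ d with G.start d = i, (G.sign d.1 : ℤ) •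
      (LaurentPolynomial.T (G.dartShift d) : ℤ[T;T⁻¹]) • y (G.start (Dart.rev d)) := by
  simp only [adjacencyMatrix, Matrix.of_apply, Finset.sum_smul, Finset.sum_filter]
  rw [Finset.sum_comm]
  refine Finset.sum_congr rfl fun d _ => ?_
  rw [Fintype.sum_eq_single (G.start (Dart.rev d)) fun j hj => by simp [hj.symm]]
  simp only [and_true, ite_smul, mul_smul, laurentPolynomial_C_smul, zero_smul]

open Classical in
theorem sum_laplacianMatrix_smul :
    ∑ j, G.laplacianMatrix i j • y j = ∑ d with G.start d = i, (G.sign d.1 : ℤ) •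
      (y i - (LaurentPolynomial.T (G.dartShift d) : ℤ[T;T⁻¹]) • y (G.start (Dart.rev d))) := by
  simp only [laplacianMatrix, Matrix.sub_apply, sub_smul, smul_sub, Finset.sum_sub_distrib,
    sum_degreeMatrix_smul, sum_adjacencyMatrix_smul]

end PeriodicGraph

namespace AnnularEmbedding

variable {V E R : Type*} [Fintype V] [Fintype E] [Fintype R] {G : PeriodicGraph V E}
  {P : AnnularEmbedding G R}

section Laplacian

theorem val_unitX_zpow (n : ℤ) :
    ((unitX ^ n : ℤ[T;T⁻¹]ˣ) : ℤ[T;T⁻¹]) = LaurentPolynomial.T n := by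
  have hX : (unitX : ℤ[T;T⁻¹]) = LaurentPolynomial.T 1 := rfl
  have hX_inv : ((unitX⁻¹ : ℤ[T;T⁻¹]ˣ) : ℤ[T;T⁻¹]) = LaurentPolynomial.T (-1) :=
    Units.inv_eq_of_mul_eq_one_right
      (by rw [hX, ← LaurentPolynomial.T_add, add_neg_cancel, LaurentPolynomial.T_zero])
  induction n with
  | zero => simp
  | succ n ih => rw [zpow_add_one, Units.val_mul, ih, hX, LaurentPolynomial.T_add]
  | pred n ih =>
    rw [zpow_sub_one, Units.val_mul, ih, hX_inv, ← LaurentPolynomial.T_add, sub_eq_add_neg]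

section Twist

variable {A : Type*} [CommRing A] (x : Aˣ) (d : E × Bool)

theorem twist_eq_zpow : P.twist x d = x ^ (Nat.card {i // P.cut i = d} : ℤ) := by
  by_cases hd : d ∈ Set.range P.cut
  · obtain ⟨i, rfl⟩ := hd
    have hcard : Nat.card {j // P.cut j = P.cut i} = 1 :=
      Nat.card_eq_one_iff_exists.2 ⟨⟨i, rfl⟩, fun j => Subtype.ext (P.cut_injective j.2)⟩
    rw [twist_cut, hcard, Nat.cast_one, zpow_one]
  · have hempty : IsEmpty {j // P.cut j = d} := ⟨fun j => hd ⟨j.1, j.2⟩⟩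
    rw [P.twist_of_notMem x hd, Nat.card_of_isEmpty, Nat.cast_zero, zpow_zero]

theorem twist_mul_inv_twist_rev :
    P.twist x d * (P.twist x (Dart.rev d))⁻¹ =
      x ^ (G.dartShift d + P.level (G.start (Dart.rev d)) - P.level (G.start d)) := by
  rw [twist_eq_zpow, twist_eq_zpow, ← zpow_neg, ← zpow_add]
  congr 1
  obtain ⟨e, _ | _⟩ := d <;> have hshift := P.shift_eq e <;>
    simp only [Dart.rev, PeriodicGraph.dartShift, PeriodicGraph.start, Bool.not_false,
      Bool.not_true, if_true, Bool.false_eq_true, if_false] <;> linarith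

theorem twist_smul_alongDiff_comp_start {W : Type*} [AddCommGroup W] [Module A W] (w : V → W) :
    P.twist x d • P.alongDiff x (w ∘ G.start) d = w (G.start d) -
      x ^ (G.dartShift d + P.level (G.start (Dart.rev d)) - P.level (G.start d)) •
        w (G.start (Dart.rev d)) := by
  rw [← twist_mul_inv_twist_rev, alongDiff, smul_sub, smul_inv_smul, smul_smul, face_apply,
    Function.comp_apply, Function.comp_apply, start_rot_symm]

end Twist

variable {W : Type*} [AddCommGroup W] [Module ℤ[T;T⁻¹] W]

/-- The powers of `x` move the representatives of the vertex orbits into one fundamental domain. -/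
theorem isSolution_laplacianMatrix_iff (w : V → W) :
    IsSolution G.laplacianMatrix (fun v => unitX ^ P.level v • w v) ↔ P.IsHarmonic unitX w := by
  classical
  refine forall_congr' fun i => ?_
  rw [G.sum_laplacianMatrix_smul, ← smul_eq_zero_iff_eq (unitX ^ (-P.level i)), Finset.smul_sum]
  refine Eq.congr_left (Finset.sum_congr (by simp) fun d hd => ?_)
  obtain rfl := (Finset.mem_filter.1 hd).2
  rw [smul_comm, twist_smul_alongDiff_comp_start, smul_sub, smul_smul, ← zpow_add,
    neg_add_cancel, zpow_zero, one_smul, ← val_unitX_zpow,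
    ← Units.smul_def (unitX ^ G.dartShift d), smul_smul, smul_smul, ← zpow_add, ← zpow_add]
  congr 4
  ring

end Laplacian

section Minor

variable {o : P.Orientation} {W : Type*} [AddCommGroup W] [Module ℤ[T;T⁻¹] W]
  [Fintype (encircledLink o).Arc] [DecidableEq (encircledLink o).Arc]
  {f : {a // a ≠ (encircledLink o).arc (.front 0)} → P.Crossing}

theorem exists_isSolution_submatrix_alexanderMatrix {e : V → W}
    (he : IsSolution G.laplacianMatrix e) :
    ∃ m : {a // a ≠ (encircledLink o).arc (.front 0)} → W,
      IsSolution (((encircledLink o).alexanderMatrix.submatrix f Subtype.val).map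
        (specialize o)) m ∧ ∀ v, e v ∈ Submodule.span ℤ[T;T⁻¹] (Set.range m) := by
  have hw : P.IsHarmonic unitX fun v => unitX ^ (-P.level v) • e v := by
    rw [← isSolution_laplacianMatrix_iff]
    simpa only [zpow_neg, smul_inv_smul] using he
  obtain ⟨α, hα, hspan⟩ := hw.exists_isColoring
  obtain ⟨a, haα, ha⟩ := hα.exists_isSolution (o := o)
  have ha₀ : a ((encircledLink o).arc (.front 0)) = 0 := (haα _).trans (hα.front 0)
  refine ⟨fun b => a b.1, (isSolution_submatrix_subtypeVal_iff _ ha₀).2 fun i => ha (f i),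
    fun v => ?_⟩
  rw [← smul_inv_smul (unitX ^ P.level v) (e v), ← zpow_neg]
  refine Submodule.smul_mem _ ((unitX ^ P.level v : ℤ[T;T⁻¹]ˣ) : ℤ[T;T⁻¹])
    (Submodule.span_le.2 (Set.range_subset_iff.2 fun s => ?_) (hspan v))
  rw [← haα]
  by_cases hs : (encircledLink o).arc s = (encircledLink o).arc (.front 0)
  · rw [hs, ha₀]
    exact Submodule.zero_mem _
  · exact Submodule.subset_span ⟨⟨_, hs⟩, rfl⟩

theorem exists_isSolution_laplacianMatrix (hf : (encircledLink o).RowsSpan f)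
    {e : {a // a ≠ (encircledLink o).arc (.front 0)} → W}
    (he : IsSolution (((encircledLink o).alexanderMatrix.submatrix f Subtype.val).map
      (specialize o)) e) :
    ∃ m, IsSolution G.laplacianMatrix m ∧
      ∀ b, e b ∈ Submodule.span ℤ[T;T⁻¹] (Set.range m) := by
  set a : (encircledLink o).Arc → W := Function.extend Subtype.val e 0
  have hae : ∀ b : {a // a ≠ (encircledLink o).arc (.front 0)}, a b = e b :=
    Subtype.val_injective.extend_apply e 0
  have ha₀ : a ((encircledLink o).arc (.front 0)) = 0 :=
    Function.extend_apply' _ _ _ fun ⟨b, hb⟩ => b.2 hb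
  have ha : IsSolution ((encircledLink o).alexanderMatrix.map (specialize o)) a := by
    refine hf.isSolution ((isSolution_submatrix_subtypeVal_iff _ ha₀).1 ?_)
    simp only [hae]
    exact he
  obtain ⟨w, hw, hspan⟩ := (isColoring_of_isSolution ha ha₀).exists_isHarmonic
  refine ⟨_, (isSolution_laplacianMatrix_iff w).2 hw, fun b => ?_⟩
  obtain ⟨s, hs⟩ := Quot.exists_rep b.1
  rw [← hae, ← hs]
  refine Submodule.span_le.2 (Set.range_subset_iff.2 fun v => ?_) (hspan s)
  rw [← inv_smul_smul (unitX ^ P.level v) (w v)]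
  exact Submodule.smul_mem _ (((unitX ^ P.level v)⁻¹ : ℤ[T;T⁻¹]ˣ) : ℤ[T;T⁻¹])
    (Submodule.subset_span ⟨v, rfl⟩)

end Minor

theorem associated_specialize_alexanderMinor {o : P.Orientation}
    {f : {a // a ≠ (encircledLink o).arc (.front 0)} → P.Crossing}
    (hf : (encircledLink o).RowsSpan f) :
    Associated G.laplacianPolynomial
      (specialize o ((encircledLink o).alexanderMinor ((encircledLink o).arc (.front 0)) f)) := by
  classical
  let : Fintype (encircledLink o).Arc := Fintype.ofFinite _
  rw [LinkDiagram.alexanderMinor_eq, RingHom.map_det]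
  exact associated_of_dvd_dvd
    (det_dvd_det_of_forall_isSolution _ _ fun _ _ _ _ he =>
      exists_isSolution_submatrix_alexanderMatrix he)
    (det_dvd_det_of_forall_isSolution _ _ fun _ _ _ _ he =>
      exists_isSolution_laplacianMatrix hf he)

theorem finite_crossing (o : P.Orientation) : Finite P.Crossing :=
  Finite.of_injective (underSegment o) ((pass_injective o).comp Sum.inr_injective)

end AnnularEmbedding

end

theorem mainTheorem3 {V E R : Type*} [Fintype V] [Fintype E] [Fintype R]
    (G : PeriodicGraph V E) (P : AnnularEmbedding G R) (o : P.Orientation) :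
    (∃ Δ, (AnnularEmbedding.encircledLink o).IsAlexanderPolynomial Δ) ∧
      ∀ Δ, (AnnularEmbedding.encircledLink o).IsAlexanderPolynomial Δ →
        Associated G.laplacianPolynomial
          ((LaurentPolynomial.T 1 - 1) * AnnularEmbedding.specialize o Δ) := by
  have := AnnularEmbedding.finite_crossing o
  obtain ⟨d, -⟩ := P.left_surjective (P.path 0)
  obtain ⟨f, hf⟩ := (AnnularEmbedding.encircledLink o).exists_rows
    ((AnnularEmbedding.encircledLink o).arc (.front 0)) (.edge d.1)
  obtain ⟨lab, hlab⟩ := AnnularEmbedding.exists_numbering o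
  have hspan := hlab.rowsSpan hf
  obtain ⟨q, hq, hminor⟩ := hspan.exists_isAlexanderPolynomial
    (j := (AnnularEmbedding.encircledLink o).arc (.front 0))
    (j₁ := (AnnularEmbedding.encircledLink o).arc (.strand d 0))
    (AnnularEmbedding.strandComponent_ne_circle o d).symm
  have hminor : AnnularEmbedding.specialize o
      ((AnnularEmbedding.encircledLink o).alexanderMinor _ f) =
        (LaurentPolynomial.T 1 - 1) * AnnularEmbedding.specialize o q := by
    rw [hminor, map_mul, map_sub, map_one]
    exact congrArg (fun p => (p - 1) * _) (AnnularEmbedding.specialize_var_circle o)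
  refine ⟨⟨q, hq⟩, fun Δ hΔ => ?_⟩
  have hassoc := AnnularEmbedding.associated_specialize_alexanderMinor hspan
  rw [hminor] at hassoc
  exact hassoc.trans (((hq.associated hΔ).map (AnnularEmbedding.specialize o)).mul_left _)
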